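/- All sets are in $\mathbb{R}^2$. Let $\Omega\subset\mathbb{R}^2$ be a Lipschitz domain, and let $V_{\rm ang}\subset\partial\Omega$ be the set of its angular points, i.e. the points of $\partial\Omega$ where the outward normal is discontinuous. A regular polytope is a set $E\setminus\bigcup_{i=1}^N \overline{I_i}$, where $E,I_1,\dots,I_N$ are bounded open sets with boundary a finite union of segments, each homeomorphic up to the boundary to the unit disc, and the $\overline{I_i}\subset E$ are pairwise disjoint; its vertices are the boundary points where two non-parallel edges meet. For $i=1,2$ let $\Omega_{{\rm p},i}$ be a regular polytope with vertex set $V_i$, and $\Psi_i:\overline{\Omega}_{{\rm p},i}\to\overline{\Omega}$ a map, such that (i) $V_i\subset\partial\Omega$; (ii) $V_{\rm ang}\subset V_i$; (iii) every straight segment contained in $\partial\Omega$ is contained in $\partial\Omega_{{\rm p},i}$; (iv) $\Psi_i$ is a Lipschitz bijection from $\overline{\Omega}_{{\rm p},i}$ to $\overline{\Omega}$ which maps $\Omega_{{\rm p},i}$ onto $\Omega$, $\Psi_i(v)=v$ for all $v\in V_i$, and $\det\nabla\Psi_i>0$ a.e. in $\Omega_{{\rm p},i}$. Let $V_i^{\rm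 fict}=V_i\setminus V_{\rm ang}$. For $x,y\in\partial\Omega$ let ${\rm dist}_{\partial\Omega}(x,y)\in[0,+\infty]$ be the infimum of the lengths $\int_0^1\|\dot\gamma\|_2\,dt$ over all $\gamma\in C^1([0,1];\partial\Omega)$ with $\gamma(0)=x$, $\gamma(1)=y$ and $\|\dot\gamma\|_2$ constant ($+\infty$ if there is no such curve), and set $$ C=\min\Big\{\min_{x\in V_1^{\rm fict},\,y\in V_2^{\rm fict}}{\rm dist}_{\partial\Omega}(x,y),\ \min_{x,y\in V_1,\,x\ne y}{\rm dist}_{\partial\Omega}(x,y),\ \min_{x,y\in V_2,\,x\neq y}{\rm dist}_{\partial\Omega}(x,y)\Big\}, $$ where a minimum over an empty set is $+\infty$. Let $\Phi$ be a $C^1$ diffeomorphism of $\Omega$ (a bijection of $\overline\Omega$ onto itself which maps $\Omega$ onto $\Omega$ and is, together with its inverse, of class $C^1$ up to the boundary) with $\det\nabla\Phi>0$ in $\Omega$ and ${\rm dist}_{\partial\Omega}(x,\Phi(x))<C$ for every $x\in\partial\Omega$. Then there exist maps $\Phi_i={\tt id}+\varphi_i$, $i=1,2$, which are homeomorphisms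 of $\overline{\Omega}_{{\rm p},i}$ onto itself mapping $\Omega_{{\rm p},i}$ onto itself, such that $$ \Phi=\Psi_1\circ\Phi_1\circ\Psi_1^{-1}\circ\Psi_2\circ\Phi_2\circ\Psi_2^{-1}\quad\text{on }\overline\Omega, \qquad \varphi_i\cdot\mathbf n=0\ \text{ on }\partial\Omega_{{\rm p},i},\quad i=1,2 $$ (at every boundary point where the normal $\mathbf n$ exists), and such that, for $i=1,2$, $\varphi_i$ is Lipschitz whenever $\Psi_i^{-1}$ is Lipschitz. -/

import Mathlib

open MeasureTheory Set Filter Topology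
open scoped ENNReal NNReal

/-- The Euclidean plane. -/
abbrev Plane : Type := EuclideanSpace ℝ (Fin 2)

/-- `ν` is the outward unit normal to `ω` at `x`: up to `o(‖y - x‖)`, the set `ω` lies on the
negative side of the line through `x` orthogonal to `ν`, and its exterior on the positive side.
For a Lipschitz domain such a `ν` is unique, and it exists exactly where the boundary has a
tangent line (for a polygon: everywhere except at the vertices). -/
def IsOutwardNormal (ω : Set Plane) (x ν : Plane) : Prop :=
  ‖ν‖ = 1 ∧ ∀ ε > 0, ∀ᶠ y in 𝓝 x,
    (y ∈ ω → inner ℝ (y - x) ν ≤ ε * ‖y - x‖) ∧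
    (y ∉ closure ω → -(ε * ‖y - x‖) ≤ inner ℝ (y - x) ν)

/-- A Lipschitz domain of the plane: a nonempty, open, connected set which, near each of its
boundary points and in suitable orthonormal coordinates, is the region strictly above the graph
of a Lipschitz function. -/
structure IsLipschitzDomain (Ω : Set Plane) : Prop where
  isOpen : IsOpen Ω
  isConnected : IsConnected Ω
  locally_epigraph : ∀ x ∈ frontier Ω, ∃ e₁ e₂ : Plane, ‖e₁‖ = 1 ∧ ‖e₂‖ = 1 ∧
    inner ℝ e₁ e₂ = 0 ∧ ∃ r > 0, ∃ (K : ℝ≥0) (f : ℝ → ℝ), LipschitzWith K f ∧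
      ∀ y ∈ Metric.ball x r, y ∈ Ω ↔ f (inner ℝ (y - x) e₁) < inner ℝ (y - x) e₂

/-- The angular points of `Ω`: the boundary points at which the outward normal is discontinuous,
that is, near which there is no continuous outward normal field on the boundary. -/
def angularPoints (Ω : Set Plane) : Set Plane :=
  {x | x ∈ frontier Ω ∧ ¬ ∃ (n : Plane → Plane), ∃ U ∈ 𝓝 x,
    ContinuousOn n (frontier Ω ∩ U) ∧ ∀ y ∈ frontier Ω ∩ U, IsOutwardNormal Ω y (n y)}

/-- A bounded (open) polytope of the plane: its boundary is a finite union of segments. -/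
structure IsBoundedPolytope (P : Set Plane) : Prop where
  isOpen : IsOpen P
  isBounded : Bornology.IsBounded P
  frontier_eq : ∃ S : Finset (Plane × Plane), frontier P = ⋃ s ∈ S, segment ℝ s.1 s.2

/-- `D` is isomorphic, up to the boundary, to the unit ball of the plane. -/
def IsIsomorphicToUnitBall (D : Set Plane) : Prop :=
  ∃ h : closure D ≃ₜ Metric.closedBall (0 : Plane) 1,
    ∀ x : closure D, (x : Plane) ∈ D ↔ (h x : Plane) ∈ Metric.ball (0 : Plane) 1

/-- A regular bounded polytope: a polytope isomorphic to the unit ball, from which finitely many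
disjoint closed polytopes isomorphic to the unit ball and compactly embedded in it are removed. -/
def IsRegularPolytope (P : Set Plane) : Prop :=
  IsBoundedPolytope P ∧ ∃ (E : Set Plane) (N : ℕ) (I : Fin N → Set Plane),
    IsBoundedPolytope E ∧ IsIsomorphicToUnitBall E ∧
    (∀ i, IsBoundedPolytope (I i) ∧ IsIsomorphicToUnitBall (I i) ∧ closure (I i) ⊆ E) ∧
    (∀ i j, i ≠ j → Disjoint (closure (I i)) (closure (I j))) ∧
    P = E \ ⋃ i, closure (I i)

/-- The vertices of a polytope: the boundary points at which two non-parallel edges meet. -/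
def polytopeVertices (P : Set Plane) : Set Plane :=
  {x | ∃ u v : Plane, LinearIndependent ℝ ![u, v] ∧
    segment ℝ x (x + u) ⊆ frontier P ∧ segment ℝ x (x + v) ⊆ frontier P}

/-- The fictitious vertices of `P`: the vertices that are not angular points of `Ω`. -/
def fictitiousVertices (Ω P : Set Plane) : Set Plane :=
  polytopeVertices P \ angularPoints Ω

/-- The compatibility conditions between a domain `Ω`, a regular polytope `P` and a map `Ψ` from
`P` to `Ω`. The map `Ψ` is considered together with its values on the closure of `P`. -/
structure IsPolytopalModel (Ω P : Set Plane) (Ψ : Plane → Plane) : Prop where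
  regular : IsRegularPolytope P
  vertices_subset : polytopeVertices P ⊆ frontier Ω
  angular_subset : angularPoints Ω ⊆ polytopeVertices P
  linear_facets : ∀ a b : Plane, a ≠ b → segment ℝ a b ⊆ frontier Ω → segment ℝ a b ⊆ frontier P
  lipschitz : ∃ K : ℝ≥0, LipschitzOnWith K Ψ (closure P)
  bijOn : BijOn Ψ P Ω
  bijOn_closure : BijOn Ψ (closure P) (closure Ω)
  eq_on_vertices : ∀ x ∈ polytopeVertices P, Ψ x = x
  jacobian_pos : ∀ᵐ x ∂(volume.restrict P), 0 < (fderiv ℝ Ψ x).det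

/-- The inverse, from `closure Ω` to `closure P`, of a bijection `Ψ` from `closure P` to
`closure Ω`. -/
noncomputable def modelInverse (P : Set Plane) (Ψ : Plane → Plane) : Plane → Plane :=
  Function.invFunOn Ψ (closure P)

/-- `C¹` curves, of constant speed, in the boundary of `Ω` from `x` to `y`. -/
def boundaryCurves (Ω : Set Plane) (x y : Plane) : Set (ℝ → Plane) :=
  {γ | ContDiffOn ℝ 1 γ (Icc 0 1) ∧ (∀ t ∈ Icc (0 : ℝ) 1, γ t ∈ frontier Ω) ∧
    γ 0 = x ∧ γ 1 = y ∧ ∃ c : ℝ, ∀ t ∈ Icc (0 : ℝ) 1, ‖derivWithin γ (Icc 0 1) t‖ = c}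

/-- The geodesic distance in the boundary of `Ω`: the infimum of the lengths of the curves in
`boundaryCurves Ω x y`, and `∞` if there is no such curve. -/
noncomputable def boundaryDist (Ω : Set Plane) (x y : Plane) : ℝ≥0∞ :=
  ⨅ γ ∈ boundaryCurves Ω x y, ENNReal.ofReal (∫ t in (0 : ℝ)..1, ‖derivWithin γ (Icc 0 1) t‖)

/-- The smallest boundary distance between two distinct vertices of `P`. -/
noncomputable def vertexSeparation (Ω P : Set Plane) : ℝ≥0∞ :=
  ⨅ x ∈ polytopeVertices P, ⨅ y ∈ polytopeVertices P, ⨅ _ : x ≠ y, boundaryDist Ω x y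

/-- The constant `C(P₁, P₂)`; a minimum over an empty set is `∞`. -/
noncomputable def deformationBound (Ω P₁ P₂ : Set Plane) : ℝ≥0∞ :=
  min (⨅ x ∈ fictitiousVertices Ω P₁, ⨅ y ∈ fictitiousVertices Ω P₂, boundaryDist Ω x y)
    (min (vertexSeparation Ω P₁) (vertexSeparation Ω P₂))

/-- `Φ` is a diffeomorphism of `Ω`, of class `C¹` up to the boundary together with its inverse. -/
structure IsDomainDiffeo (Ω : Set Plane) (Φ : Plane → Plane) : Prop where
  bijOn : BijOn Φ Ω Ω
  bijOn_closure : BijOn Φ (closure Ω) (closure Ω)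
  contDiffOn : ContDiffOn ℝ 1 Φ (closure Ω)
  contDiffOn_inverse : ∃ Θ : Plane → Plane, ContDiffOn ℝ 1 Θ (closure Ω) ∧
    InvOn Θ Φ (closure Ω) (closure Ω)

/-- `id + φ` is a homeomorphism of `P` up to the boundary (its inverse is continuous because
`closure P` is compact) and the normal component of `φ` vanishes on the boundary of `P`. -/
structure IsTangentialDisplacement (P : Set Plane) (φ : Plane → Plane) : Prop where
  continuousOn : ContinuousOn φ (closure P)
  bijOn : BijOn (fun x => x + φ x) P P
  bijOn_closure : BijOn (fun x => x + φ x) (closure P) (closure P)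
  normal_eq_zero : ∀ x ∈ frontier P, ∀ ν : Plane, IsOutwardNormal P x ν → inner ℝ (φ x) ν = 0


/-!
It suffices to find a bi-Lipschitz bijection `B` of the plane which preserves `Ω`, fixes the
vertices of `P₂`, and agrees with `Φ` at the boundary points that `Φ` sends to vertices of `P₁`.
Then `Φ = (Φ ∘ B⁻¹) ∘ B`, the maps `Φ₁ = Ψ₁⁻¹ ∘ (Φ ∘ B⁻¹) ∘ Ψ₁` and `Φ₂ = Ψ₂⁻¹ ∘ B ∘ Ψ₂` fix the
vertices of `P₁` and of `P₂`, and a homeomorphism of a polygon fixing the vertices preserves every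
edge, so its displacement is tangential.

The map `B` moves, one at a time, the preimages under `Φ` of the vertices of `P₁` to their targets,
by pushing along a connected piece of `∂Ω`. Only fictitious vertices have to be reached, because `Φ`
permutes the angular points and cannot exchange two of them at this distance. The curves that
compute the boundary distance give connected pieces containing at most one vertex of `P₁` and, if
they contain a fictitious vertex of `P₁`, no vertex of `P₂`. Transported to `∂P₁` by `Ψ₁⁻¹`, such a
piece can be shrunk to a segment of an edge; since `Φ` cannot reverse the order of points along an
edge, the segment contains the preimage of no other vertex.
-/

section Bilipschitz

variable {X Y Z : Type*} [PseudoEMetricSpace X] [PseudoEMetricSpace Y]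
  [PseudoEMetricSpace Z]

/-- A bijection which is Lipschitz together with its inverse. -/
def IsBilipschitz (e : X ≃ Y) : Prop :=
  (∃ K, LipschitzWith K e) ∧ ∃ K, LipschitzWith K e.symm

theorem IsBilipschitz.symm {e : X ≃ Y} (he : IsBilipschitz e) : IsBilipschitz e.symm :=
  And.symm he

theorem IsBilipschitz.trans {e : X ≃ Y} {e' : Y ≃ Z} (he : IsBilipschitz e)
    (he' : IsBilipschitz e') : IsBilipschitz (e.trans e') := by
  obtain ⟨⟨K, hK⟩, L, hL⟩ := he
  obtain ⟨⟨K', hK'⟩, L', hL'⟩ := he'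
  exact ⟨⟨K' * K, hK'.comp hK⟩, L * L', hL.comp hL'⟩

theorem isBilipschitz_isometryEquiv (e : X ≃ᵢ Y) : IsBilipschitz e.toEquiv :=
  ⟨⟨1, e.isometry.lipschitz⟩, 1, e.symm.isometry.lipschitz⟩

/-- The homeomorphism underlying a bi-Lipschitz bijection. -/
def IsBilipschitz.toHomeomorph {e : X ≃ Y} (he : IsBilipschitz e) : X ≃ₜ Y where
  toEquiv := e
  continuous_toFun := he.1.choose_spec.continuous
  continuous_invFun := he.2.choose_spec.continuous

/-- The group of the bi-Lipschitz permutations of `X` which preserve `Ω` and fix the points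
of `F`. -/
def fixingGroup (Ω F : Set X) : Subgroup (Equiv.Perm X) where
  carrier := {B | IsBilipschitz B ∧ (∀ x, B x ∈ Ω ↔ x ∈ Ω) ∧ ∀ x ∈ F, B x = x}
  one_mem' := ⟨isBilipschitz_isometryEquiv (IsometryEquiv.refl X), fun _ => Iff.rfl,
    fun _ _ => rfl⟩
  mul_mem' := fun ⟨hA, hAΩ, hAF⟩ ⟨hB, hBΩ, hBF⟩ =>
    ⟨hB.trans hA, fun _ => (hAΩ _).trans (hBΩ _), fun x hx => by
      rw [Equiv.Perm.mul_apply, hBF x hx, hAF x hx]⟩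
  inv_mem' := fun {B} ⟨hB, hBΩ, hBF⟩ =>
    ⟨hB.symm, fun x => by simpa using (hBΩ (B⁻¹ x)).symm,
      fun x hx => Equiv.Perm.inv_eq_iff_eq.2 (hBF x hx).symm⟩

variable {Ω F G : Set X} {B : Equiv.Perm X}

theorem fixingGroup_antitone (h : F ⊆ G) : fixingGroup Ω G ≤ fixingGroup Ω F :=
  fun _ ⟨hB, hBΩ, hBG⟩ => ⟨hB, hBΩ, fun x hx => hBG x (h hx)⟩

theorem bijOn_of_mem_fixingGroup (hB : B ∈ fixingGroup Ω F) : BijOn B Ω Ω :=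
  B.bijOn fun x => hB.2.1 x

theorem bijOn_closure_of_mem_fixingGroup (hB : B ∈ fixingGroup Ω F) :
    BijOn B (closure Ω) (closure Ω) := by
  have himage : B '' closure Ω = closure Ω :=
    (hB.1.toHomeomorph.image_closure Ω).trans
      (congrArg closure (bijOn_of_mem_fixingGroup hB).image_eq)
  simpa only [himage] using B.injective.injOn.bijOn_image (s := closure Ω)

end Bilipschitz

section Push

variable {E : Type*} [NormedAddCommGroup E] [NormedSpace ℝ E] [CompleteSpace E]

theorem exists_isBilipschitz_add {φ : E → E} {c : ℝ≥0} (hφ : LipschitzWith c φ) (hc : c < 1) :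
    ∃ D : Equiv.Perm E, IsBilipschitz D ∧ ∀ x, D x = x + φ x := by
  have hanti : AntilipschitzWith (1⁻¹ - c)⁻¹ fun x => x + φ x :=
    AntilipschitzWith.id.add_lipschitzWith hφ (by simpa using hc)
  have happrox : ApproximatesLinearOn (fun x => x + φ x)
      (ContinuousLinearEquiv.refl ℝ E : E →L[ℝ] E) univ c :=
    ApproximatesLinearOn.approximatesLinearOn_iff_lipschitzOnWith.2 <| lipschitzOnWith_univ.2 <| by
      convert! hφ using 1
      ext x
      simp
  have hsurj : Function.Surjective fun x => x + φ x := by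
    refine happrox.surjective ((subsingleton_or_nontrivial E).imp_right fun hE => ?_)
    have : NontrivialTopology E := EMetric.nontrivial_iff_nontrivialTopology.1 hE
    simpa using hc
  let D := Equiv.ofBijective _ ⟨hanti.injective, hsurj⟩
  exact ⟨D, ⟨⟨_, LipschitzWith.id.add hφ⟩, _, hanti.to_rightInverse D.right_inv⟩, fun _ => rfl⟩

theorem exists_isBilipschitz_push {a b : E} {ρ : ℝ} (h : dist b a < ρ) :
    ∃ D : Equiv.Perm E, IsBilipschitz D ∧ D a = b ∧ (∀ x, ∃ t : ℝ, D x = x + t • (b - a)) ∧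
      (∀ x, ρ ≤ dist x a → D x = x) ∧ ∀ x, dist x a < ρ → dist (D x) a < ρ := by
  have hρ : 0 < ρ := dist_nonneg.trans_lt h
  let χ : E → ℝ := fun x => max 0 (1 - dist x a / ρ)
  have hχ : ∀ x y, |χ x - χ y| ≤ dist x y / ρ := fun x y => by
    refine (abs_max_sub_max_le_max _ _ _ _).trans ?_
    rw [sub_self, abs_zero, sub_sub_sub_cancel_left, ← sub_div, abs_div, abs_of_pos hρ,
      abs_sub_comm]
    exact max_le (by positivity) (by gcongr; exact abs_dist_sub_le x y a)
  have hlip : LipschitzWith (nndist b a / ρ.toNNReal) fun x => χ x • (b - a) :=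
    LipschitzWith.of_dist_le_mul fun x y => by
      rw [dist_eq_norm, ← sub_smul, norm_smul, Real.norm_eq_abs, ← dist_eq_norm b a,
        NNReal.coe_div, coe_nndist, Real.coe_toNNReal _ hρ.le, div_mul_comm]
      exact mul_le_mul_of_nonneg_right (hχ x y) dist_nonneg
  have hlt : nndist b a / ρ.toNNReal < 1 := by
    rw [div_lt_one (by simpa using hρ), ← NNReal.coe_lt_coe, Real.coe_toNNReal _ hρ.le]
    exact h
  obtain ⟨D, hD, hDx⟩ := exists_isBilipschitz_add hlip hlt
  have hfar : ∀ x, ρ ≤ dist x a → D x = x := fun x hx => by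
    have : χ x = 0 := max_eq_left (by rwa [sub_nonpos, one_le_div hρ])
    rw [hDx, this, zero_smul, add_zero]
  refine ⟨D, hD, by simp [hDx, χ], fun x => ⟨χ x, hDx x⟩, hfar, fun x hx => ?_⟩
  by_contra! h
  rw [D.injective (hfar _ h)] at h
  exact h.not_gt hx

end Push

section BoundaryChart

open Metric

theorem mul_abs_inner_lt_inner {E : Type*} [NormedAddCommGroup E] [InnerProductSpace ℝ E]
    {e₁ e₂ w : E} (he₁ : ‖e₁‖ = 1) (he₂ : ‖e₂‖ = 1) (horth : inner ℝ e₁ e₂ = 0) {K : ℝ≥0}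
    (hw : ‖w‖ ≤ 1 / (K + 2)) : K * |inner ℝ (e₂ + w) e₁| < inner ℝ (e₂ + w) e₂ := by
  have hw₁ : |inner ℝ w e₁| ≤ ‖w‖ := by simpa [he₁] using abs_real_inner_le_norm w e₁
  have hw₂ : |inner ℝ w e₂| ≤ ‖w‖ := by simpa [he₂] using abs_real_inner_le_norm w e₂
  rw [inner_add_left, inner_add_left, real_inner_comm, horth, zero_add,
    real_inner_self_eq_norm_sq, he₂, one_pow]
  rw [le_div_iff₀ (by positivity)] at hw
  have hlt : (K + 1) * ‖w‖ < 1 := by nlinarith [norm_nonneg w]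
  linarith [mul_le_mul_of_nonneg_left hw₁ K.coe_nonneg, neg_abs_le (inner ℝ w e₂)]

theorem exists_continuousLinearEquiv_prod {e₁ e₂ : Plane} (he₁ : ‖e₁‖ = 1) (he₂ : ‖e₂‖ = 1)
    (horth : inner ℝ e₁ e₂ = 0) :
    ∃ L : Plane ≃L[ℝ] ℝ × ℝ, ∀ y, L y = (inner ℝ y e₁, inner ℝ y e₂) := by
  have hon : Orthonormal ℝ ![e₁, e₂] := by
    simp [orthonormal_vecCons_iff, he₁, he₂, horth]
  have hspan := hon.linearIndependent.span_eq_top_of_card_eq_finrank (by simp)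
  let b := OrthonormalBasis.mk hon hspan.ge
  refine ⟨(b.repr.toContinuousLinearEquiv.trans (EuclideanSpace.equiv (Fin 2) ℝ)).trans
    (ContinuousLinearEquiv.finTwoArrow ℝ ℝ), fun y => ?_⟩
  ext <;> simp [b, OrthonormalBasis.repr_apply_apply, real_inner_comm]

theorem isBilipschitz_continuousLinearEquiv {E F : Type*} [NormedAddCommGroup E] [NormedSpace ℝ E]
    [NormedAddCommGroup F] [NormedSpace ℝ F] (L : E ≃L[ℝ] F) : IsBilipschitz L.toEquiv :=
  ⟨⟨_, L.lipschitz⟩, _, L.symm.lipschitz⟩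

theorem isBilipschitz_prodShear {f : ℝ → ℝ} {K : ℝ≥0} (hf : LipschitzWith K f) :
    IsBilipschitz (Equiv.prodShear (Equiv.refl ℝ) fun s => Equiv.subRight (f s)) :=
  ⟨⟨_, LipschitzWith.prod_fst.prodMk
      (LipschitzWith.prod_snd.sub (hf.comp LipschitzWith.prod_fst))⟩,
    _, LipschitzWith.prod_fst.prodMk
      (LipschitzWith.prod_snd.add (hf.comp LipschitzWith.prod_fst))⟩

/-- On the ball of radius `r` about `q`, the map `S` straightens `Ω` to the upper half plane. The
second coordinate of `S` increases in all the directions of a cone with axis `e`. -/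
structure IsBoundaryChart (Ω : Set Plane) (q : Plane) (r : ℝ) (S : Plane ≃ ℝ × ℝ) (e : Plane)
    (κ : ℝ) : Prop where
  radius_pos : 0 < r
  isBilipschitz : IsBilipschitz S
  mem_iff : ∀ y ∈ ball q r, y ∈ Ω ↔ 0 < (S y).2
  aperture_pos : 0 < κ
  height_lt : ∀ x w : Plane, ‖w‖ ≤ κ → ∀ t : ℝ, 0 < t → (S x).2 < (S (x + t • (e + w))).2

theorem IsLipschitzDomain.exists_isBoundaryChart {Ω : Set Plane} (hΩ : IsLipschitzDomain Ω)
    {q : Plane} (hq : q ∈ frontier Ω) : ∃ r S e κ, IsBoundaryChart Ω q r S e κ := by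
  obtain ⟨e₁, e₂, he₁, he₂, horth, r, hr, K, f, hf, hmem⟩ := hΩ.locally_epigraph q hq
  obtain ⟨L, hL⟩ := exists_continuousLinearEquiv_prod he₁ he₂ horth
  let S : Plane ≃ ℝ × ℝ := (IsometryEquiv.subRight q).toEquiv.trans
    (L.toEquiv.trans (Equiv.prodShear (Equiv.refl ℝ) fun s => Equiv.subRight (f s)))
  have hS₂ : ∀ y, (S y).2 = inner ℝ (y - q) e₂ - f (inner ℝ (y - q) e₁) := fun y => by
    simp [S, hL]
  refine ⟨r, S, e₂, 1 / (K + 2), hr,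
    (isBilipschitz_isometryEquiv _).trans
      ((isBilipschitz_continuousLinearEquiv L).trans (isBilipschitz_prodShear hf)),
    fun y hy => by rw [hmem y hy, hS₂, sub_pos], by positivity, fun x w hw t ht => ?_⟩
  have hcone := mul_abs_inner_lt_inner he₁ he₂ horth hw
  have hfx := hf.dist_le_mul (inner ℝ (x + t • (e₂ + w) - q) e₁) (inner ℝ (x - q) e₁)
  rw [Real.dist_eq, Real.dist_eq, ← inner_sub_left, sub_sub_sub_cancel_right,
    add_sub_cancel_left, real_inner_smul_left, abs_mul, abs_of_pos ht] at hfx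
  rw [hS₂, hS₂, add_sub_right_comm, inner_add_left _ _ e₂, real_inner_smul_left,
    ← add_sub_right_comm]
  nlinarith [le_of_abs_le hfx]

namespace IsBoundaryChart

variable {Ω : Set Plane} {q : Plane} {r : ℝ} {S : Plane ≃ ℝ × ℝ} {e : Plane} {κ : ℝ}

theorem mem_closure_iff (hS : IsBoundaryChart Ω q r S e κ) {y : Plane} (hy : y ∈ ball q r) :
    y ∈ closure Ω ↔ 0 ≤ (S y).2 := by
  have hlocal : ∀ᶠ z in 𝓝 y, z ∈ Ω ↔ z ∈ S ⁻¹' (univ ×ˢ Ioi 0) := by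
    filter_upwards [isOpen_ball.mem_nhds hy] with z hz
    simp [hS.mem_iff z hz]
  calc y ∈ closure Ω ↔ y ∈ closure (hS.isBilipschitz.toHomeomorph ⁻¹' (univ ×ˢ Ioi 0)) := by
        rw [mem_closure_iff_frequently, mem_closure_iff_frequently]
        exact frequently_congr hlocal
    _ ↔ 0 ≤ (S y).2 := by
        rw [← Homeomorph.preimage_closure, closure_prod_eq, closure_univ, closure_Ioi]
        simp [IsBilipschitz.toHomeomorph]

theorem mem_frontier_iff (hS : IsBoundaryChart Ω q r S e κ) (hΩ : IsOpen Ω) {y : Plane}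
    (hy : y ∈ ball q r) : y ∈ frontier Ω ↔ (S y).2 = 0 := by
  rw [hΩ.frontier_eq, Set.mem_sdiff, hS.mem_closure_iff hy, hS.mem_iff y hy, not_lt, antisymm_iff,
    eq_comm]

end IsBoundaryChart

namespace IsLipschitzDomain

variable {Ω F : Set Plane} {q : Plane}

theorem eventually_exists_mem_fixingGroup (hΩ : IsLipschitzDomain Ω) (hF : IsClosed F)
    (hq : q ∈ frontier Ω) (hqF : q ∉ F) :
    ∀ᶠ y in 𝓝[frontier Ω] q, ∃ B ∈ fixingGroup Ω F, B q = y := by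
  obtain ⟨r, S, e, κ, hS⟩ := hΩ.exists_isBoundaryChart hq
  let S' := hS.isBilipschitz.toHomeomorph
  have hSq : (S q).2 = 0 := (hS.mem_frontier_iff hΩ.isOpen (mem_ball_self hS.radius_pos)).1 hq
  have hU : ball q r ∩ Fᶜ ∈ 𝓝 q :=
    inter_mem (ball_mem_nhds q hS.radius_pos) (hF.isOpen_compl.mem_nhds hqF)
  obtain ⟨ρ, hρ, hSρ⟩ : ∃ ρ > 0, ∀ x, dist (S x) (S q) < ρ → x ∈ ball q r ∩ Fᶜ := by
    rw [S'.isInducing.nhds_eq_comap] at hU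
    exact (nhds_basis_ball.comap S').mem_iff.1 hU
  have hnear : ∀ᶠ y in 𝓝 q, dist (S y) (S q) < ρ :=
    S'.continuous.continuousAt.eventually (ball_mem_nhds _ hρ)
  filter_upwards [self_mem_nhdsWithin, nhdsWithin_le_nhds hnear] with y hyΩ hy
  have hSy : (S y).2 = 0 := (hS.mem_frontier_iff hΩ.isOpen (hSρ y hy).1).1 hyΩ
  obtain ⟨D, hD, hDq, hDline, hDfar, hDnear⟩ := exists_isBilipschitz_push hy
  have hD₂ : ∀ p, (D p).2 = p.2 := fun p => by
    obtain ⟨t, ht⟩ := hDline p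
    simp [ht, hSy, hSq]
  refine ⟨S.trans (D.trans S.symm), ⟨hS.isBilipschitz.trans (hD.trans hS.isBilipschitz.symm),
    fun x => ?_, fun x hx => ?_⟩, by simp [hDq]⟩
  · rcases le_or_gt ρ (dist (S x) (S q)) with hx | hx
    · simp [hDfar _ hx]
    · rw [hS.mem_iff _ (hSρ _ (by simpa using hDnear _ hx)).1, hS.mem_iff x (hSρ x hx).1]
      simp [hD₂]
  · have hfar : ρ ≤ dist (S x) (S q) := not_lt.1 fun h => (hSρ x h).2 hx
    simp [hDfar _ hfar]

theorem exists_mem_fixingGroup (hΩ : IsLipschitzDomain Ω) (hF : IsClosed F) {K : Set Plane}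
    (hK : IsPreconnected K) (hKΩ : K ⊆ frontier Ω) (hKF : Disjoint K F) {p q : Plane} (hp : p ∈ K)
    (hq : q ∈ K) : ∃ B ∈ fixingGroup Ω F, B p = q := by
  refine hK.induction₂ (fun p q => ∃ B ∈ fixingGroup Ω F, B p = q) (fun x hx => ?_) ?_ ?_ hp hq
  · exact nhdsWithin_mono _ hKΩ
      (hΩ.eventually_exists_mem_fixingGroup hF (hKΩ hx) (disjoint_left.1 hKF hx))
  · rintro x y z - - - ⟨A, hA, rfl⟩ ⟨B, hB, rfl⟩
    exact ⟨B * A, mul_mem hB hA, rfl⟩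
  · rintro x y - - ⟨A, hA, rfl⟩
    exact ⟨A⁻¹, inv_mem hA, A.symm_apply_apply x⟩

end IsLipschitzDomain

end BoundaryChart

section ContDiff

open Metric AffineMap

variable {X Y E F : Type*} [PseudoMetricSpace X] [PseudoMetricSpace Y]
  [NormedAddCommGroup E] [NormedSpace ℝ E] [NormedAddCommGroup F] [NormedSpace ℝ F]

theorem lipschitzOnWith_of_eventually_dist_le {s : Set E} (hs : Convex ℝ s) {f : E → Y} {C : ℝ≥0}
    (hf : ∀ x ∈ s, ∀ᶠ y in 𝓝[s] x, dist (f y) (f x) ≤ C * dist y x) : LipschitzOnWith C f s := by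
  refine LipschitzOnWith.of_dist_le_mul fun y hy x hx => ?_
  let γ : ℝ → E := lineMap x y
  have hγs : MapsTo γ (Icc 0 1) s := fun t ht => hs.lineMap_mem hx hy ht
  have hγ : ∀ t ∈ Icc (0 : ℝ) 1, ∀ᶠ z in 𝓝[Icc 0 1] t,
      dist (f (γ z)) (f (γ t)) ≤ C * dist y x * |z - t| := fun t ht => by
    have hcont : Tendsto γ (𝓝[Icc 0 1] t) (𝓝[s] (γ t)) :=
      (lineMap_continuous.continuousWithinAt).tendsto_nhdsWithin hγs
    filter_upwards [hcont.eventually (hf _ (hγs ht))] with z hz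
    rwa [dist_lineMap_lineMap, Real.dist_eq, mul_comm |z - t|, ← mul_assoc, dist_comm x y] at hz
  have hbound : ∀ t ∈ Icc (0 : ℝ) 1, dist (f (γ t)) (f x) ≤ C * dist y x * t := by
    refine image_le_of_liminf_slope_right_le_deriv_boundary (B' := fun _ => C * dist y x)
      (fun t ht => ?_) (by simp [γ]) (by fun_prop)
      (fun t _ => by simpa using! ((hasDerivAt_id t).const_mul (C * dist y x)).hasDerivWithinAt)
      (fun t ht r hr => ?_)
    · refine Tendsto.dist (tendsto_iff_dist_tendsto_zero.2 ?_) tendsto_const_nhds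
      refine squeeze_zero' (.of_forall fun _ => dist_nonneg) (hγ t ht) ?_
      have : Continuous fun z => C * dist y x * |z - t| := by fun_prop
      simpa using (this.tendsto t).mono_left (nhdsWithin_le_nhds (s := Icc 0 1))
    · refine Eventually.frequently ?_
      have hIcc : 𝓝[>] t ≤ 𝓝[Icc 0 1] t :=
        nhdsWithin_le_of_mem (mem_of_superset (Ioc_mem_nhdsGT ht.2)
          fun z hz => ⟨ht.1.trans hz.1.le, hz.2⟩)
      filter_upwards [hIcc (hγ t (Ico_subset_Icc_self ht)), self_mem_nhdsWithin] with z hz htz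
      have htz' : 0 < z - t := sub_pos.2 htz
      rw [slope_def_field, div_lt_iff₀ htz']
      rw [abs_of_pos htz'] at hz
      have := dist_triangle (f (γ z)) (f (γ t)) (f x)
      nlinarith
  simpa [γ] using hbound 1 (by simp)

theorem lipschitzOnWith_of_convex_image {e : X ≃ E} {K L : ℝ≥0} (he : LipschitzWith K e)
    (he' : LipschitzWith L e.symm) {s : Set X} (hs : Convex ℝ (e '' s)) {f : X → Y} {C : ℝ≥0}
    (hf : ∀ x ∈ s, ∀ᶠ y in 𝓝[s] x, dist (f y) (f x) ≤ C * dist y x) :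
    LipschitzOnWith (C * L * K) f s := by
  have hcomp : LipschitzOnWith (C * L) (f ∘ e.symm) (e '' s) := by
    refine lipschitzOnWith_of_eventually_dist_le hs ?_
    rintro _ ⟨x, hx, rfl⟩
    have hcont : Tendsto e.symm (𝓝[e '' s] (e x)) (𝓝[s] x) := by
      have := he'.continuous.continuousWithinAt.tendsto_nhdsWithin (s := e '' s) (x := e x)
        (t := s) (by rintro _ ⟨z, hz, rfl⟩; simpa using hz)
      simpa using this
    filter_upwards [hcont.eventually (hf x hx)] with p hp
    have := he'.dist_le_mul p (e x)
    simp only [Function.comp_apply, e.symm_apply_apply, NNReal.coe_mul] at this ⊢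
    nlinarith [C.coe_nonneg]
  have := hcomp.comp he.lipschitzOnWith (mapsTo_image e s)
  simpa [Function.comp_assoc] using this

theorem eventually_dist_le_of_hasFDerivWithinAt {f : E → F} {f' : E →L[ℝ] F} {s : Set E} {x : E}
    (hf : HasFDerivWithinAt f f' s x) {C : ℝ} (hC : ‖f'‖ < C) :
    ∀ᶠ y in 𝓝[s] x, dist (f y) (f x) ≤ C * dist y x := by
  filter_upwards [hf.isLittleO.def (sub_pos.2 hC)] with y hy
  rw [dist_eq_norm, dist_eq_norm]
  linarith [norm_le_insert (f' (y - x)) (f y - f x), norm_sub_rev (f' (y - x)) (f y - f x),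
    f'.le_opNorm (y - x)]

theorem exists_eventually_dist_le_of_contDiffOn {f : E → F} {s : Set E} (hs : IsCompact s)
    (hs' : UniqueDiffOn ℝ s) (hf : ContDiffOn ℝ 1 f s) :
    ∃ C : ℝ≥0, ∀ x ∈ s, ∀ᶠ y in 𝓝[s] x, dist (f y) (f x) ≤ C * dist y x := by
  obtain ⟨C, hC⟩ := hs.exists_bound_of_continuousOn (hf.continuousOn_fderivWithin hs' le_rfl)
  refine ⟨(C + 1).toNNReal, fun x hx => ?_⟩
  refine eventually_dist_le_of_hasFDerivWithinAt
    (hf.differentiableOn one_ne_zero x hx).hasFDerivWithinAt ?_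
  exact (lt_add_of_le_of_pos (hC x hx) one_pos).trans_le (Real.le_coe_toNNReal _)

namespace IsBoundaryChart

variable {Ω : Set Plane} {q : Plane} {r : ℝ} {S : Plane ≃ ℝ × ℝ} {e : Plane} {κ : ℝ}

theorem add_smul_mem (hS : IsBoundaryChart Ω q r S e κ) {x w : Plane} {t : ℝ} (hx : x ∈ closure Ω)
    (hxr : x ∈ ball q r) (hw : ‖w‖ ≤ κ) (ht : 0 < t) (hr : x + t • (e + w) ∈ ball q r) :
    x + t • (e + w) ∈ Ω :=
  (hS.mem_iff _ hr).2 <| ((hS.mem_closure_iff hxr).1 hx).trans_lt (hS.height_lt x w hw t ht)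

theorem sub_smul_notMem_closure (hS : IsBoundaryChart Ω q r S e κ) {x w : Plane} {t : ℝ}
    (hx : x ∉ Ω) (hxr : x ∈ ball q r) (hw : ‖w‖ ≤ κ) (ht : 0 < t)
    (hr : x - t • (e + w) ∈ ball q r) : x - t • (e + w) ∉ closure Ω := by
  have hlt := hS.height_lt (x - t • (e + w)) w hw t ht
  rw [sub_add_cancel] at hlt
  rw [hS.mem_iff x hxr] at hx
  rw [hS.mem_closure_iff hr]
  exact not_le.2 (hlt.trans_le (not_lt.1 hx))

end IsBoundaryChart

theorem tendsto_add_smul_nhdsGT_zero (q d : E) :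
    Tendsto (fun t : ℝ => q + t • d) (𝓝[>] 0) (𝓝 q) := by
  have hcont : Continuous fun t : ℝ => q + t • d := by fun_prop
  simpa using (hcont.tendsto 0).mono_left (nhdsWithin_le_nhds (s := Ioi 0))

namespace IsLipschitzDomain

variable {Ω : Set Plane} {q : Plane}

theorem uniqueDiffOn_closure (hΩ : IsLipschitzDomain Ω) : UniqueDiffOn ℝ (closure Ω) := by
  intro x hx
  by_cases hxΩ : x ∈ Ω
  · exact (hΩ.isOpen.uniqueDiffWithinAt hxΩ).mono subset_closure
  obtain ⟨r, S, e, κ, hS⟩ := hΩ.exists_isBoundaryChart (hΩ.isOpen.frontier_eq.ge ⟨hx, hxΩ⟩)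
  have hcone : ball e κ ⊆ tangentConeAt ℝ (closure Ω) x := fun d hd => by
    refine mem_tangentConeAt_of_add_smul_mem (α := ℝ) (l := 𝓝[>] 0) (c := id)
      (tendsto_id.mono_right (nhdsGT_le_nhdsNE 0)) ?_
    filter_upwards [tendsto_add_smul_nhdsGT_zero x d (ball_mem_nhds x hS.radius_pos),
      self_mem_nhdsWithin] with t hr ht
    have := hS.add_smul_mem hx (mem_ball_self hS.radius_pos) (mem_ball_iff_norm.1 hd).le ht
    simp only [add_sub_cancel] at this
    exact subset_closure (this hr)
  have hspan : Submodule.span ℝ (tangentConeAt ℝ (closure Ω) x) = ⊤ :=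
    Submodule.eq_top_of_nonempty_interior' _ ⟨e, mem_interior.2
      ⟨_, hcone.trans Submodule.subset_span, isOpen_ball, mem_ball_self hS.aperture_pos⟩⟩
  exact ⟨hspan ▸ dense_univ, subset_closure hx⟩

theorem frontier_subset_closure_compl_closure (hΩ : IsLipschitzDomain Ω) :
    frontier Ω ⊆ closure (closure Ω)ᶜ := fun x hx => by
  obtain ⟨r, S, e, κ, hS⟩ := hΩ.exists_isBoundaryChart hx
  have hxΩ : x ∉ Ω := (hΩ.isOpen.frontier_eq.le hx).2
  have hlim : Tendsto (fun t : ℝ => x - t • e) (𝓝[>] 0) (𝓝 x) := by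
    simpa [sub_eq_add_neg] using tendsto_add_smul_nhdsGT_zero x (-e)
  refine mem_closure_of_tendsto hlim ?_
  filter_upwards [hlim.eventually (ball_mem_nhds x hS.radius_pos), self_mem_nhdsWithin] with t hr ht
  simpa using hS.sub_smul_notMem_closure hxΩ (mem_ball_self hS.radius_pos)
    (w := 0) (by simpa using hS.aperture_pos.le) ht (by simpa using hr)

theorem exists_lipschitzOnWith_mem_nhdsWithin (hΩ : IsLipschitzDomain Ω) {f : Plane → Y} {C : ℝ≥0}
    (hf : ∀ x ∈ closure Ω, ∀ᶠ y in 𝓝[closure Ω] x, dist (f y) (f x) ≤ C * dist y x)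
    (hq : q ∈ closure Ω) : ∃ K, ∃ s ∈ 𝓝[closure Ω] q, LipschitzOnWith K f s := by
  by_cases hqΩ : q ∈ Ω
  · obtain ⟨ρ, hρ, hball⟩ := isOpen_iff.1 hΩ.isOpen q hqΩ
    refine ⟨C, ball q ρ, mem_nhdsWithin_of_mem_nhds (ball_mem_nhds q hρ),
      lipschitzOnWith_of_eventually_dist_le (convex_ball q ρ) fun x hx => ?_⟩
    have hsub := hball.trans subset_closure
    exact nhdsWithin_mono _ hsub (hf x (hsub hx))
  obtain ⟨r, S, e, κ, hS⟩ := hΩ.exists_isBoundaryChart (hΩ.isOpen.frontier_eq.ge ⟨hq, hqΩ⟩)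
  obtain ⟨⟨K, hK⟩, L, hL⟩ := hS.isBilipschitz
  obtain ⟨ρ, hρ, hball⟩ : ∃ ρ > 0, S.symm '' ball (S q) ρ ⊆ ball q r := by
    have := hL.continuous.tendsto (S q) (ball_mem_nhds _ hS.radius_pos)
    rw [S.symm_apply_apply] at this
    simpa only [image_subset_iff] using nhds_basis_ball.mem_iff.1 this
  let s := closure Ω ∩ S ⁻¹' ball (S q) ρ
  have himage : S '' s = ball (S q) ρ ∩ {p | 0 ≤ p.2} := by
    ext p
    rw [S.image_eq_preimage_symm]
    simp only [s, mem_preimage, mem_inter_iff, S.apply_symm_apply, and_comm (a := _ ∈ closure Ω)]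
    refine and_congr_right fun hp => ?_
    rw [hS.mem_closure_iff (hball (mem_image_of_mem _ hp)), S.apply_symm_apply, mem_ofPred_eq]
  have hconvex : Convex ℝ (S '' s) := himage ▸ (convex_ball _ _).inter
    (convex_halfSpace_ge (LinearMap.snd ℝ ℝ ℝ).isLinear 0)
  exact ⟨_, s, inter_mem_nhdsWithin _ (hK.continuous.tendsto q (ball_mem_nhds _ hρ)),
    lipschitzOnWith_of_convex_image hK hL hconvex fun x hx =>
      nhdsWithin_mono _ inter_subset_left (hf x hx.1)⟩

theorem exists_lipschitzOnWith_of_contDiffOn (hΩ : IsLipschitzDomain Ω)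
    (hc : IsCompact (closure Ω)) {f : Plane → F} (hf : ContDiffOn ℝ 1 f (closure Ω)) :
    ∃ K, LipschitzOnWith K f (closure Ω) := by
  obtain ⟨C, hC⟩ := exists_eventually_dist_le_of_contDiffOn hc hΩ.uniqueDiffOn_closure hf
  exact LocallyLipschitzOn.exists_lipschitzOnWith_of_compact hc fun x hx =>
    hΩ.exists_lipschitzOnWith_mem_nhdsWithin hC hx

end IsLipschitzDomain

end ContDiff

section OutwardNormal

variable {E F : Type*} [NormedAddCommGroup E] [NormedSpace ℝ E] [NormedAddCommGroup F]
  [NormedSpace ℝ F]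

/-- The Fréchet normal cone of `A` at `x`: the functionals `ℓ` with `ℓ (y - x) ≤ o(‖y - x‖)` as
`y` tends to `x` in `A`. -/
def frechetNormalCone (A : Set E) (x : E) : Set (E →L[ℝ] ℝ) :=
  {ℓ | ∀ ε > 0, ∀ᶠ y in 𝓝[A] x, ℓ (y - x) ≤ ε * ‖y - x‖}

variable {A B : Set E} {x : E} {ℓ : E →L[ℝ] ℝ}

theorem frechetNormalCone_antitone (h : A ⊆ B) :
    frechetNormalCone B x ⊆ frechetNormalCone A x :=
  fun _ hℓ ε hε => nhdsWithin_mono x h (hℓ ε hε)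

theorem frechetNormalCone_closure (A : Set E) (x : E) :
    frechetNormalCone (closure A) x = frechetNormalCone A x := by
  refine (frechetNormalCone_antitone subset_closure).antisymm fun ℓ hℓ ε hε => ?_
  rw [eventually_nhdsWithin_iff]
  filter_upwards [(eventually_nhdsWithin_iff.1 (hℓ ε hε)).eventually_nhds] with y hy hyA
  have hclosed : IsClosed {z | ℓ (z - x) ≤ ε * ‖z - x‖} :=
    isClosed_le (by fun_prop) (by fun_prop)
  exact hclosed.mem_of_frequently_of_tendsto
    ((mem_closure_iff_frequently.1 hyA).mp (hy.mono fun _ h hA => h hA)) tendsto_id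

theorem smul_mem_frechetNormalCone (hℓ : ℓ ∈ frechetNormalCone A x) {c : ℝ} (hc : 0 < c) :
    c • ℓ ∈ frechetNormalCone A x := fun ε hε => by
  filter_upwards [hℓ (c⁻¹ * ε) (by positivity)] with y hy
  rwa [mul_assoc, ← div_eq_inv_mul, le_div_iff₀' hc] at hy

theorem nonpos_of_mem_frechetNormalCone (hℓ : ℓ ∈ frechetNormalCone A x) {d : E}
    (hd : ∀ᶠ t in 𝓝[>] (0 : ℝ), x + t • d ∈ A) : ℓ d ≤ 0 := by
  have hlim : Tendsto (fun t : ℝ => x + t • d) (𝓝[>] 0) (𝓝[A] x) :=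
    tendsto_nhdsWithin_iff.2 ⟨tendsto_add_smul_nhdsGT_zero x d, hd⟩
  have hbound : ∀ ε > 0, ℓ d ≤ ε * ‖d‖ := fun ε hε => by
    obtain ⟨t, ht, ht₀⟩ := ((hlim.eventually (hℓ ε hε)).and self_mem_nhdsWithin).exists
    rw [add_sub_cancel_left, map_smul, norm_smul, Real.norm_of_nonneg ht₀.le, smul_eq_mul,
      mul_left_comm] at ht
    exact le_of_mul_le_mul_left ht ht₀
  have hzero : Tendsto (fun ε : ℝ => ε * ‖d‖) (𝓝[>] 0) (𝓝 0) := by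
    simpa using (tendsto_id.mul_const ‖d‖).mono_left (nhdsWithin_le_nhds (a := (0 : ℝ)))
  exact ge_of_tendsto hzero (eventually_nhdsWithin_of_forall hbound)

theorem comp_mem_frechetNormalCone {f : E → F} {f' : E →L[ℝ] F} (hf : HasFDerivWithinAt f f' A x)
    {C : Set F} (hfA : MapsTo f A C) {ℓ : F →L[ℝ] ℝ} (hℓ : ℓ ∈ frechetNormalCone C (f x)) :
    ℓ.comp f' ∈ frechetNormalCone A x := fun ε hε => by
  let δ := ε / (‖f'‖ + 1 + ‖ℓ‖)
  have hδ : 0 < δ := by positivity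
  have hlim : Tendsto f (𝓝[A] x) (𝓝[C] f x) := hf.continuousWithinAt.tendsto_nhdsWithin hfA
  filter_upwards [hlim.eventually (hℓ δ hδ), hf.isLittleO.def hδ,
    eventually_dist_le_of_hasFDerivWithinAt hf (lt_add_one ‖f'‖)] with y hy hremainder hlip
  rw [dist_eq_norm, dist_eq_norm] at hlip
  calc ℓ (f' (y - x)) = ℓ (f y - f x) - ℓ (f y - f x - f' (y - x)) := by rw [← map_sub]; simp
    _ ≤ δ * ‖f y - f x‖ + ‖ℓ‖ * ‖f y - f x - f' (y - x)‖ := by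
      linarith [neg_le_of_abs_le (ℓ.le_opNorm (f y - f x - f' (y - x)))]
    _ ≤ δ * ((‖f'‖ + 1) * ‖y - x‖) + ‖ℓ‖ * (δ * ‖y - x‖) := by gcongr
    _ = ε * ‖y - x‖ := by simp only [δ]; field_simp

theorem mem_frechetNormalCone_of_exists_add_smul_mem (hℓ : ℓ ∈ frechetNormalCone B x) {e : E}
    (he : 0 ≤ ℓ e) {M : ℝ} (hM : 0 ≤ M)
    (h : ∀ᶠ z in 𝓝[A] x, ∃ s, 0 ≤ s ∧ s ≤ M * ‖z - x‖ ∧ z + s • e ∈ B) :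
    ℓ ∈ frechetNormalCone A x := fun ε hε => by
  let c := 1 + M * ‖e‖
  have hc : 0 < c := by positivity
  obtain ⟨ρ, hρ, hball⟩ := Metric.mem_nhdsWithin_iff.1 (hℓ (ε / c) (by positivity))
  filter_upwards [h, mem_nhdsWithin_of_mem_nhds (Metric.ball_mem_nhds x (div_pos hρ hc))]
    with z ⟨s, hs, hsM, hsB⟩ hz
  have hnorm : ‖z + s • e - x‖ ≤ c * ‖z - x‖ := by
    have := norm_add_le (z - x) (s • e)
    rw [norm_smul, Real.norm_of_nonneg hs, ← add_sub_right_comm] at this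
    linarith [mul_le_mul_of_nonneg_right hsM (norm_nonneg e)]
  have hmem : z + s • e ∈ Metric.ball x ρ := by
    rw [mem_ball_iff_norm, lt_div_iff₀' hc] at hz
    exact mem_ball_iff_norm.2 (hnorm.trans_lt hz)
  calc ℓ (z - x) ≤ ℓ (z - x) + s * ℓ e := le_add_of_nonneg_right (mul_nonneg hs he)
    _ = ℓ (z + s • e - x) := by simp; ring
    _ ≤ ε / c * ‖z + s • e - x‖ := hball ⟨hmem, hsB⟩
    _ ≤ ε / c * (c * ‖z - x‖) := by gcongr
    _ = ε * ‖z - x‖ := by field_simp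

theorem fderivWithin_comp_fderivWithin_of_leftInvOn {f : E → F} {g : F → E} {C : Set F}
    (hA : UniqueDiffWithinAt ℝ A x) (hx : x ∈ A) (hf : DifferentiableWithinAt ℝ f A x)
    (hg : DifferentiableWithinAt ℝ g C (f x)) (hfA : MapsTo f A C) (hgf : LeftInvOn g f A) :
    (fderivWithin ℝ g C (f x)).comp (fderivWithin ℝ f A x) = ContinuousLinearMap.id ℝ E := by
  rw [← fderivWithin_comp x hg hf hfA hA, fderivWithin_congr (f₁ := g ∘ f) (f := id) hgf (hgf hx),
    fderivWithin_id hA]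

theorem IsBoundaryChart.eventually_exists_add_smul_mem_frontier {Ω : Set Plane} {q : Plane} {r : ℝ}
    {S : Plane ≃ ℝ × ℝ} {e : Plane} {κ : ℝ} (hS : IsBoundaryChart Ω q r S e κ) (hΩ : IsOpen Ω)
    (hq : q ∈ frontier Ω) : ∀ᶠ z in 𝓝[(closure Ω)ᶜ] q,
      ∃ s, 0 ≤ s ∧ s ≤ κ⁻¹ * ‖z - q‖ ∧ z + s • e ∈ frontier Ω := by
  have hκ := hS.aperture_pos
  have hr := hS.radius_pos
  filter_upwards [self_mem_nhdsWithin, mem_nhdsWithin_of_mem_nhds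
    (Metric.ball_mem_nhds q (by positivity : 0 < r / (1 + κ⁻¹ * ‖e‖)))] with z hz hzr
  rw [mem_ball_iff_norm, lt_div_iff₀' (by positivity)] at hzr
  have hpos : 0 < ‖z - q‖ :=
    norm_sub_pos_iff.2 fun h => hz (h ▸ frontier_subset_closure hq)
  let s₀ := κ⁻¹ * ‖z - q‖
  have hs₀ : 0 < s₀ := by positivity
  have hball : ∀ s ∈ Icc 0 s₀, z + s • e ∈ Metric.ball q r := fun s hs => by
    rw [mem_ball_iff_norm, add_sub_right_comm]
    refine (norm_add_le _ _).trans_lt (lt_of_le_of_lt ?_ hzr)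
    rw [norm_smul, Real.norm_of_nonneg hs.1]
    linarith [mul_le_mul_of_nonneg_right hs.2 (norm_nonneg e)]
  have hbelow : (S (z + (0 : ℝ) • e)).2 < 0 := by
    have hmem := hball 0 (left_mem_Icc.2 hs₀.le)
    refine not_le.1 fun h => hz ?_
    simpa using (hS.mem_closure_iff hmem).2 h
  have habove : 0 < (S (z + s₀ • e)).2 := by
    have hw : ‖s₀⁻¹ • (z - q)‖ ≤ κ := by
      rw [norm_smul, norm_inv, Real.norm_of_nonneg hs₀.le]
      exact le_of_eq (by simp only [s₀]; field_simp)
    have hlt := hS.height_lt q _ hw s₀ hs₀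
    rw [(hS.mem_frontier_iff hΩ (Metric.mem_ball_self hr)).1 hq, smul_add,
      smul_inv_smul₀ hs₀.ne'] at hlt
    rwa [show z + s₀ • e = q + (s₀ • e + (z - q)) by abel]
  obtain ⟨⟨K, hK⟩, -⟩ := hS.isBilipschitz
  have hcont : Continuous fun s : ℝ => (S (z + s • e)).2 :=
    (hK.continuous.comp (by fun_prop)).snd
  obtain ⟨s, hs, hs0⟩ := intermediate_value_Icc hs₀.le hcont.continuousOn ⟨hbelow.le, habove.le⟩
  exact ⟨s, hs.1, hs.2, (hS.mem_frontier_iff hΩ (hball s hs)).2 hs0⟩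

/-- Unlike the exterior of `Ω`, the sets `closure Ω` and `frontier Ω` are preserved by a
diffeomorphism of `Ω` up to the boundary. -/
theorem IsLipschitzDomain.isOutwardNormal_iff {Ω : Set Plane} (hΩ : IsLipschitzDomain Ω)
    {x ν : Plane} (hx : x ∈ frontier Ω) : IsOutwardNormal Ω x ν ↔
      ‖ν‖ = 1 ∧ innerSL ℝ ν ∈ frechetNormalCone (closure Ω) x ∧
        -innerSL ℝ ν ∈ frechetNormalCone (frontier Ω) x := by
  have hiff : IsOutwardNormal Ω x ν ↔ ‖ν‖ = 1 ∧ innerSL ℝ ν ∈ frechetNormalCone Ω x ∧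
      -innerSL ℝ ν ∈ frechetNormalCone (closure Ω)ᶜ x := by
    simp only [IsOutwardNormal, frechetNormalCone, eventually_and, forall_and, mem_ofPred_eq,
      eventually_nhdsWithin_iff, neg_apply, innerSL_apply_apply, neg_le,
      real_inner_comm, mem_compl_iff]
  rw [hiff, frechetNormalCone_closure]
  refine and_congr_right fun _ => and_congr_right fun hν => ⟨fun h => ?_, fun h => ?_⟩
  · exact frechetNormalCone_antitone hΩ.frontier_subset_closure_compl_closure
      ((frechetNormalCone_closure _ x).symm ▸ h)
  · obtain ⟨r, S, e, κ, hS⟩ := hΩ.exists_isBoundaryChart hx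
    have hinward : ∀ᶠ t in 𝓝[>] (0 : ℝ), x + t • e ∈ Ω := by
      filter_upwards [tendsto_add_smul_nhdsGT_zero x e (Metric.ball_mem_nhds x hS.radius_pos),
        self_mem_nhdsWithin] with t ht ht₀
      simpa using hS.add_smul_mem (frontier_subset_closure hx) (Metric.mem_ball_self hS.radius_pos)
        (w := 0) (by simpa using hS.aperture_pos.le) ht₀ (by simpa using ht)
    exact mem_frechetNormalCone_of_exists_add_smul_mem h
      (neg_nonneg.2 (nonpos_of_mem_frechetNormalCone hν hinward)) (inv_nonneg.2 hS.aperture_pos.le)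
      (hS.eventually_exists_add_smul_mem_frontier hΩ.isOpen hx)

theorem bijOn_frontier {X Y : Type*} [TopologicalSpace X] [TopologicalSpace Y] {U : Set X}
    {V : Set Y} (hU : IsOpen U) (hV : IsOpen V) {f : X → Y} (hf : BijOn f U V)
    (hf' : BijOn f (closure U) (closure V)) : BijOn f (frontier U) (frontier V) := by
  rw [hU.frontier_eq, hV.frontier_eq, ← hf'.image_eq, ← hf.image_eq,
    ← hf'.injOn.image_sdiff_subset subset_closure]
  exact (hf'.injOn.mono sdiff_subset).bijOn_image

namespace IsDomainDiffeo

open ContinuousLinearMap (adjoint)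

variable {Ω : Set Plane} {Φ : Plane → Plane}

theorem exists_inverse (hΦ : IsDomainDiffeo Ω Φ) :
    ∃ Θ, IsDomainDiffeo Ω Θ ∧ InvOn Θ Φ (closure Ω) (closure Ω) := by
  obtain ⟨Θ, hΘ, hinv⟩ := hΦ.contDiffOn_inverse
  exact ⟨Θ, ⟨hΦ.bijOn.symm (hinv.symm.mono subset_closure subset_closure),
    hΦ.bijOn_closure.symm hinv.symm, hΘ, Φ, hΦ.contDiffOn, hinv.symm⟩, hinv⟩

theorem isOutwardNormal_adjoint (hΦ : IsDomainDiffeo Ω Φ) (hΩ : IsLipschitzDomain Ω)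
    {x ν : Plane} (hx : x ∈ frontier Ω) (hν : IsOutwardNormal Ω (Φ x) ν) {N : Plane}
    (hN : N = adjoint (fderivWithin ℝ Φ (closure Ω) x) ν) :
    N ≠ 0 ∧ IsOutwardNormal Ω x (‖N‖⁻¹ • N) := by
  obtain ⟨Θ, hΘ, hinv⟩ := hΦ.exists_inverse
  have hxc := frontier_subset_closure hx
  have hΦx := hΦ.bijOn_closure.mapsTo hxc
  have hΦfr := bijOn_frontier hΩ.isOpen hΩ.isOpen hΦ.bijOn hΦ.bijOn_closure
  have hΦd := hΦ.contDiffOn.differentiableOn one_ne_zero x hxc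
  have hΘd := hΘ.contDiffOn.differentiableOn one_ne_zero (Φ x) hΦx
  obtain ⟨hν₁, hνc, hνf⟩ := (hΩ.isOutwardNormal_iff (hΦfr.mapsTo hx)).1 hν
  have hpull : innerSL ℝ N = (innerSL ℝ ν).comp (fderivWithin ℝ Φ (closure Ω) x) := by
    ext w
    simp [hN, ContinuousLinearMap.adjoint_inner_left]
  have hN₀ : N ≠ 0 := by
    have hid := fderivWithin_comp_fderivWithin_of_leftInvOn (hΩ.uniqueDiffOn_closure _ hΦx) hΦx
      hΘd (by rwa [hinv.1 hxc]) hΘ.bijOn_closure.mapsTo hinv.2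
    rw [hinv.1 hxc] at hid
    intro h
    have : innerSL ℝ ν = 0 := by
      rw [← (innerSL ℝ ν).comp_id, ← hid, ← ContinuousLinearMap.comp_assoc, ← hpull, h, map_zero,
        ContinuousLinearMap.zero_comp]
    simpa [hν₁] using congrArg norm this
  have hpos : 0 < ‖N‖⁻¹ := inv_pos.2 (norm_pos_iff.2 hN₀)
  refine ⟨hN₀, (hΩ.isOutwardNormal_iff hx).2 ⟨norm_smul_inv_norm hN₀, ?_, ?_⟩⟩
  · rw [map_smul, hpull]
    exact smul_mem_frechetNormalCone (comp_mem_frechetNormalCone hΦd.hasFDerivWithinAt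
      hΦ.bijOn_closure.mapsTo hνc) hpos
  · rw [map_smul, ← smul_neg, hpull, ← ContinuousLinearMap.neg_comp]
    exact smul_mem_frechetNormalCone (comp_mem_frechetNormalCone
      (hΦd.hasFDerivWithinAt.mono frontier_subset_closure) hΦfr.mapsTo hνf) hpos

theorem mapsTo_angularPoints (hΦ : IsDomainDiffeo Ω Φ) (hΩ : IsLipschitzDomain Ω) :
    MapsTo Φ (angularPoints Ω) (angularPoints Ω) := by
  have hΦfr := bijOn_frontier hΩ.isOpen hΩ.isOpen hΦ.bijOn hΦ.bijOn_closure
  refine fun x hx => ⟨hΦfr.mapsTo hx.1, ?_⟩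
  rintro ⟨n, U, hU, hn, hnormal⟩
  have hΦU : Φ ⁻¹' U ∈ 𝓝[frontier Ω] x :=
    (hΦ.contDiffOn.continuousOn.mono frontier_subset_closure) x hx.1 hU
  obtain ⟨W, hW, hWU⟩ := mem_nhdsWithin_iff_exists_mem_nhds_inter.1 hΦU
  have hmaps : MapsTo Φ (frontier Ω ∩ W) (frontier Ω ∩ U) := fun y hy =>
    ⟨hΦfr.mapsTo hy.1, hWU ⟨hy.2, hy.1⟩⟩
  have hsub : frontier Ω ∩ W ⊆ closure Ω := inter_subset_left.trans frontier_subset_closure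
  let N : Plane → Plane := fun y => adjoint (fderivWithin ℝ Φ (closure Ω) y) (n (Φ y))
  have hN : ∀ y ∈ frontier Ω ∩ W, N y ≠ 0 ∧ IsOutwardNormal Ω y (‖N y‖⁻¹ • N y) := fun y hy =>
    hΦ.isOutwardNormal_adjoint hΩ hy.1 (hnormal _ (hmaps hy)) rfl
  have hcont : ContinuousOn N (frontier Ω ∩ W) := by
    refine ContinuousOn.clm_apply ?_ (hn.comp (hΦ.contDiffOn.continuousOn.mono hsub) hmaps)
    exact adjoint.continuous.comp_continuousOn
      ((hΦ.contDiffOn.continuousOn_fderivWithin hΩ.uniqueDiffOn_closure le_rfl).mono hsub)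
  exact hx.2 ⟨_, W, hW, (hcont.norm.inv₀ fun y hy => norm_ne_zero_iff.2 (hN y hy).1).smul hcont,
    fun y hy => (hN y hy).2⟩

theorem surjOn_angularPoints (hΦ : IsDomainDiffeo Ω Φ) (hΩ : IsLipschitzDomain Ω) :
    SurjOn Φ (angularPoints Ω) (angularPoints Ω) := by
  obtain ⟨Θ, hΘ, hinv⟩ := hΦ.exists_inverse
  exact fun y hy => ⟨Θ y, hΘ.mapsTo_angularPoints hΩ hy, hinv.2 (frontier_subset_closure hy.1)⟩

end IsDomainDiffeo

end OutwardNormal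

section Link

variable {X : Type*} [TopologicalSpace X] {F V T : Set X} {x y : X}

/-- The connected part `T` of `F` joins `x` and `y` and contains at most one corner. -/
structure IsLink (F V T : Set X) (x y : X) : Prop where
  isPreconnected : IsPreconnected T
  subset : T ⊆ F
  left_mem : x ∈ T
  right_mem : y ∈ T
  subsingleton : (V ∩ T).Subsingleton

theorem IsLink.symm (hT : IsLink F V T x y) : IsLink F V T y x :=
  ⟨hT.isPreconnected, hT.subset, hT.right_mem, hT.left_mem, hT.subsingleton⟩

/-- A continuous injective map of `F` into itself which moves every point within a connected part
of `F` containing at most one corner. -/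
structure IsLinkedMap (F V : Set X) (g : X → X) : Prop where
  continuousOn : ContinuousOn g F
  injOn : InjOn g F
  mapsTo : MapsTo g F F
  exists_isLink : ∀ x ∈ F, ∃ T, IsLink F V T x (g x)

theorem IsLinkedMap.apply_eq_of_mem {g : X → X} (hg : IsLinkedMap F V g) (hV : V ⊆ F)
    (hx : x ∈ V) (hgx : g x ∈ V) : g x = x := by
  obtain ⟨T, hT⟩ := hg.exists_isLink x (hV hx)
  exact hT.subsingleton ⟨hgx, hT.right_mem⟩ ⟨hx, hT.left_mem⟩

end Link

section PolygonalCurve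

variable {E : Type*} [NormedAddCommGroup E] [NormedSpace ℝ E] {F V T : Set E} {a b x y : E}

theorem isInducing_lineMap (hab : a ≠ b) : IsInducing (AffineMap.lineMap a b : ℝ → E) :=
  ((antilipschitzWith_lineMap hab).isUniformInducing
    (lipschitzWith_lineMap a b).uniformContinuous).isInducing

theorem isClosed_segment (a b : E) : IsClosed (segment ℝ a b) := by
  rw [segment_eq_image_lineMap]
  exact (isCompact_Icc.image AffineMap.lineMap_continuous).isClosed

theorem openSegment_lineMap_lineMap (a b : E) {s t : ℝ} (h : s < t) :
    openSegment ℝ (AffineMap.lineMap a b s) (AffineMap.lineMap a b t) =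
      AffineMap.lineMap a b '' Ioo s t := by
  rw [← openSegment_eq_Ioo h, image_openSegment]

theorem segment_subset_of_isPreconnected (hT : IsPreconnected T) (hTab : T ⊆ segment ℝ a b)
    (ha : a ∈ T) (hb : b ∈ T) : segment ℝ a b ⊆ T := by
  rcases eq_or_ne a b with rfl | hab
  · simpa using ha
  rw [segment_eq_image_lineMap] at hTab ⊢
  have hpre : (AffineMap.lineMap a b : ℝ → E) '' (AffineMap.lineMap a b ⁻¹' T) = T :=
    image_preimage_eq_of_subset (hTab.trans (image_subset_range _ _))
  rw [← hpre, (isInducing_lineMap hab).isPreconnected_image] at hT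
  rw [image_subset_iff]
  exact hT.ordConnected.out (by simpa using ha) (by simpa using hb)

/-- A compact set `F` which, near each of its points outside the closed set `V` of its corners,
coincides with a straight line. -/
structure IsPolygonal (F V : Set E) : Prop where
  isCompact : IsCompact F
  isClosed_corners : IsClosed V
  corners_subset : V ⊆ F
  eventually_mem_iff : ∀ x ∈ F \ V, ∃ y ≠ x, ∀ᶠ z in 𝓝 x, (z ∈ F ↔ z ∈ line[ℝ, x, y])

/-- The segment between the corners `a` and `b` is an edge of `F`: without its end points, it is
a relatively open part of `F` which contains no corner. -/
structure IsEdge (F V : Set E) (a b : E) : Prop where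
  left_mem : a ∈ V
  right_mem : b ∈ V
  ne : a ≠ b
  subset : openSegment ℝ a b ⊆ F \ V
  mem_nhdsWithin : ∀ y ∈ openSegment ℝ a b, openSegment ℝ a b ∈ 𝓝[F] y

theorem exists_Ioo_subset_of_isOpen {A : Set ℝ} (hA : IsOpen A) (hb : Bornology.IsBounded A)
    {t : ℝ} (ht : t ∈ A) : ∃ α β, t ∈ Ioo α β ∧ Ioo α β ⊆ A ∧ α ∉ A ∧ β ∉ A := by
  set C := connectedComponentIn A t
  have hCo : IsOpen C := hA.connectedComponentIn
  have htC : t ∈ C := mem_connectedComponentIn ht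
  have hCb : Bornology.IsBounded C := hb.subset (connectedComponentIn_subset A t)
  have hne : C.Nonempty := ⟨t, htC⟩
  have hCI : C ⊆ Ioo (sInf C) (sSup C) := interior_Icc (a := sInf C) ▸
    hCo.subset_interior_iff.2 (subset_Icc_csInf_csSup hCb.bddBelow hCb.bddAbove)
  have hmem : ∀ c ∈ closure C, c ∈ A → c ∈ C := fun c hc hcA =>
    (isPreconnected_connectedComponentIn.subset_closure (subset_insert c C)
      (insert_subset hc subset_closure)).subset_connectedComponentIn (mem_insert_of_mem c htC)
      (insert_subset hcA (connectedComponentIn_subset A t)) (mem_insert c C)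
  refine ⟨sInf C, sSup C, hCI htC, ?_, fun h => ?_, fun h => ?_⟩
  · exact (IsConnected.Ioo_csInf_csSup_subset ⟨hne, isPreconnected_connectedComponentIn⟩
      hCb.bddBelow hCb.bddAbove).trans (connectedComponentIn_subset A t)
  · exact lt_irrefl _ (hCI (hmem _ (csInf_mem_closure hne hCb.bddBelow) h)).1
  · exact lt_irrefl _ (hCI (hmem _ (csSup_mem_closure hne hCb.bddAbove) h)).2

namespace IsPolygonal

theorem eventually_mem_iff_of_frequently (h : IsPolygonal F V) (hx : x ∈ F \ V)
    (hxab : x ∈ line[ℝ, a, b]) (hfreq : ∃ᶠ z in 𝓝[≠] x, z ∈ F ∧ z ∈ line[ℝ, a, b]) :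
    ∀ᶠ z in 𝓝 x, (z ∈ F ↔ z ∈ line[ℝ, a, b]) := by
  obtain ⟨y, -, hF⟩ := h.eventually_mem_iff x hx
  obtain ⟨z, ⟨hzF, hzab⟩, hz, hzx⟩ := (hfreq.and_eventually
    ((hF.filter_mono nhdsWithin_le_nhds).and self_mem_nhdsWithin)).exists
  rwa [← affineSpan_pair_eq_of_mem_of_mem_of_ne (left_mem_affineSpan_pair ℝ x y) (hz.1 hzF)
    (Ne.symm hzx), affineSpan_pair_eq_of_mem_of_mem_of_ne hxab hzab (Ne.symm hzx)] at hF

/-- The parameters `t` at which `F` coincides, near the point with parameter `t` of the line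
through `x` and `y`, with this line, the corners being excluded. -/
def straightParameters (F V : Set E) (x y : E) : Set ℝ :=
  {t | AffineMap.lineMap x y t ∉ V ∧
    ∀ᶠ z in 𝓝 (AffineMap.lineMap x y t), (z ∈ F ↔ z ∈ line[ℝ, x, y])}

theorem lineMap_mem_of_mem_straightParameters {t : ℝ} (ht : t ∈ straightParameters F V x y) :
    AffineMap.lineMap x y t ∈ F \ V :=
  ⟨ht.2.self_of_nhds.2 (AffineMap.lineMap_mem_affineSpan_pair t x y), ht.1⟩

theorem isOpen_straightParameters (h : IsPolygonal F V) :
    IsOpen (straightParameters F V x y) :=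
  (h.isClosed_corners.isOpen_compl.inter isOpen_setOfPred_eventually_nhds).preimage
    AffineMap.lineMap_continuous

theorem isBounded_straightParameters (h : IsPolygonal F V) (hxy : x ≠ y) :
    Bornology.IsBounded (straightParameters F V x y) :=
  ((antilipschitzWith_lineMap hxy).isBounded_preimage h.isCompact.isBounded).subset
    fun _ ht => (lineMap_mem_of_mem_straightParameters ht).1

theorem lineMap_mem_corners (h : IsPolygonal F V) (hxy : x ≠ y) {t : ℝ}
    (ht : t ∈ closure (straightParameters F V x y)) (htA : t ∉ straightParameters F V x y) :
    AffineMap.lineMap x y t ∈ V := by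
  by_contra htV
  have hc : Continuous (AffineMap.lineMap x y : ℝ → E) := AffineMap.lineMap_continuous
  have htF : AffineMap.lineMap x y t ∈ F :=
    closure_minimal (fun s hs => (lineMap_mem_of_mem_straightParameters hs).1)
      (h.isCompact.isClosed.preimage hc) ht
  refine htA ⟨htV, h.eventually_mem_iff_of_frequently ⟨htF, htV⟩
    (AffineMap.lineMap_mem_affineSpan_pair t x y) (frequently_nhdsWithin_iff.2 ?_)⟩
  refine (hc.tendsto t).frequently ((mem_closure_iff_frequently.1 ht).mono fun s hs => ?_)
  exact ⟨⟨(lineMap_mem_of_mem_straightParameters hs).1,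
    AffineMap.lineMap_mem_affineSpan_pair s x y⟩,
    (AffineMap.lineMap_injective ℝ hxy).ne fun hst => htA (hst ▸ hs)⟩

theorem image_lineMap_mem_nhdsWithin (hxy : x ≠ y) {t : ℝ}
    (ht : t ∈ straightParameters F V x y) {N : Set ℝ} (hN : N ∈ 𝓝 t) :
    AffineMap.lineMap x y '' N ∈ 𝓝[F] (AffineMap.lineMap x y t) := by
  have hrange : range (AffineMap.lineMap x y : ℝ → E) = line[ℝ, x, y] :=
    ext fun _ => mem_affineSpan_pair_iff_exists_lineMap_eq.symm
  have heq : F =ᶠ[𝓝 (AffineMap.lineMap x y t)] range (AffineMap.lineMap x y : ℝ → E) := by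
    filter_upwards [ht.2] with z hz
    rw [hrange]
    exact propext hz
  rw [nhdsWithin_eq_iff_eventuallyEq.2 heq]
  exact (isInducing_lineMap hxy).image_mem_nhdsWithin hN

theorem exists_isEdge (h : IsPolygonal F V) (hx : x ∈ F \ V) :
    ∃ a b, IsEdge F V a b ∧ x ∈ openSegment ℝ a b := by
  obtain ⟨y, hyx, hxy⟩ := h.eventually_mem_iff x hx
  have h0 : (0 : ℝ) ∈ straightParameters F V x y := by
    simpa only [straightParameters, mem_ofPred_eq, AffineMap.lineMap_apply_zero] using
      And.intro hx.2 hxy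
  obtain ⟨α, β, h0αβ, hsub, hα, hβ⟩ := exists_Ioo_subset_of_isOpen
    h.isOpen_straightParameters (h.isBounded_straightParameters hyx.symm) h0
  have hαβ : α < β := h0αβ.1.trans h0αβ.2
  have hcl : Icc α β ⊆ closure (straightParameters F V x y) :=
    closure_Ioo hαβ.ne ▸ closure_mono hsub
  have hseg := openSegment_lineMap_lineMap x y hαβ
  refine ⟨AffineMap.lineMap x y α, AffineMap.lineMap x y β, ⟨?_, ?_, ?_, ?_, ?_⟩, ?_⟩
  · exact h.lineMap_mem_corners hyx.symm (hcl (left_mem_Icc.2 hαβ.le)) hα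
  · exact h.lineMap_mem_corners hyx.symm (hcl (right_mem_Icc.2 hαβ.le)) hβ
  · exact (AffineMap.lineMap_injective ℝ hyx.symm).ne hαβ.ne
  · rw [hseg]
    exact image_subset_iff.2 fun t ht => lineMap_mem_of_mem_straightParameters (hsub ht)
  · rw [hseg]
    rintro _ ⟨t, ht, rfl⟩
    exact image_lineMap_mem_nhdsWithin hyx.symm (hsub ht) (Ioo_mem_nhds ht.1 ht.2)
  · rw [hseg]
    exact ⟨0, h0αβ, AffineMap.lineMap_apply_zero x y⟩

end IsPolygonal

theorem subset_openSegment_of_isPreconnected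
    (hopen : ∀ y ∈ openSegment ℝ a b, openSegment ℝ a b ∈ 𝓝[F] y) (hT : IsPreconnected T)
    (hTF : T ⊆ F) (ha : a ∉ T) (hb : b ∉ T) (hx : x ∈ T) (hxab : x ∈ openSegment ℝ a b) :
    T ⊆ openSegment ℝ a b := by
  let U := {y : E | ∀ᶠ z in 𝓝 y, z ∈ F → z ∈ openSegment ℝ a b}
  have hTU : ∀ y ∈ T, y ∈ U → y ∈ openSegment ℝ a b := fun y hy hyU =>
    Eventually.self_of_nhds hyU (hTF hy)
  have hcover : T ⊆ U ∪ (segment ℝ a b)ᶜ := by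
    refine fun y hy => or_iff_not_imp_right.2 fun hyab => ?_
    have hyo := mem_openSegment_of_ne_left_right (ne_of_mem_of_not_mem hy ha).symm
      (ne_of_mem_of_not_mem hy hb).symm (not_not.1 hyab)
    exact eventually_nhdsWithin_iff.1 (hopen y hyo)
  have hdisj : T ∩ (U ∩ (segment ℝ a b)ᶜ) = ∅ := eq_empty_of_forall_notMem
    fun y hy => hy.2.2 (openSegment_subset_segment ℝ a b (hTU y hy.1 hy.2.1))
  rcases isPreconnected_iff_subset_of_disjoint.1 hT U (segment ℝ a b)ᶜ
    isOpen_setOfPred_eventually_nhds (isClosed_segment a b).isOpen_compl hcover hdisj with h | h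
  · exact fun y hy => hTU y hy (h hy)
  · exact absurd (openSegment_subset_segment ℝ a b hxab) (h hx)

theorem openSegment_eq_of_mem_pair {a' b' : E} (hab : a ≠ b) (ha : a ∈ ({a', b'} : Set E))
    (hb : b ∈ ({a', b'} : Set E)) : openSegment ℝ a' b' = openSegment ℝ a b := by
  rcases ha with rfl | rfl <;> rcases hb with rfl | rfl
  · exact absurd rfl hab
  · rfl
  · exact openSegment_symm ℝ _ _
  · exact absurd rfl hab

namespace IsEdge

theorem symm (he : IsEdge F V a b) : IsEdge F V b a where
  left_mem := he.right_mem
  right_mem := he.left_mem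
  ne := he.ne.symm
  subset := openSegment_symm ℝ a b ▸ he.subset
  mem_nhdsWithin := openSegment_symm ℝ a b ▸ he.mem_nhdsWithin

theorem segment_subset (he : IsEdge F V a b) (hV : V ⊆ F) : segment ℝ a b ⊆ F := by
  rw [← insert_endpoints_openSegment]
  exact insert_subset (hV he.left_mem) (insert_subset (hV he.right_mem)
    (he.subset.trans sdiff_subset))

theorem left_mem_or_right_mem (he : IsEdge F V a b) (hT : IsPreconnected T) (hTF : T ⊆ F)
    (hx : x ∈ T) (hxab : x ∈ openSegment ℝ a b) (hy : y ∈ T) (hyab : y ∉ openSegment ℝ a b) :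
    a ∈ T ∨ b ∈ T := by
  by_contra! h
  exact hyab (subset_openSegment_of_isPreconnected he.mem_nhdsWithin hT hTF h.1 h.2 hx hxab hy)

theorem openSegment_lineMap_mem_nhdsWithin (he : IsEdge F V a b) {s : ℝ} (hs : s ∈ Ico 0 1)
    (hy : y ∈ openSegment ℝ (AffineMap.lineMap a b s) b) :
    openSegment ℝ (AffineMap.lineMap a b s) b ∈ 𝓝[F] y := by
  have hseg := openSegment_lineMap_lineMap a b hs.2
  rw [AffineMap.lineMap_apply_one] at hseg
  rw [hseg] at hy ⊢
  obtain ⟨t, ht, rfl⟩ := hy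
  have hta : AffineMap.lineMap a b t ∈ openSegment ℝ a b :=
    openSegment_eq_image_lineMap ℝ a b ▸ mem_image_of_mem _ ⟨hs.1.trans_lt ht.1, ht.2⟩
  have hle : 𝓝[F] (AffineMap.lineMap a b t) ≤
      𝓝[range (AffineMap.lineMap a b : ℝ → E)] (AffineMap.lineMap a b t) := by
    refine (nhdsWithin_le_of_mem (he.mem_nhdsWithin _ hta)).trans (nhdsWithin_mono _ ?_)
    exact openSegment_eq_image_lineMap ℝ a b ▸ image_subset_range _ _
  exact hle ((isInducing_lineMap he.ne).image_mem_nhdsWithin (Ioo_mem_nhds ht.1 ht.2))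

theorem lineMap_mem_of_isPreconnected (he : IsEdge F V a b) (hT : IsPreconnected T)
    (hTF : T ⊆ F) (ha : a ∈ T) (hb : b ∉ T) {s t : ℝ} (hs : s ∈ Icc 0 t) (ht : t < 1)
    (htT : AffineMap.lineMap a b t ∈ T) : AffineMap.lineMap a b s ∈ T := by
  rcases hs.2.eq_or_lt with rfl | hst
  · exact htT
  by_contra hsT
  have hsb := openSegment_lineMap_lineMap a b (hst.trans ht)
  rw [AffineMap.lineMap_apply_one] at hsb
  have hmem : AffineMap.lineMap a b (0 : ℝ) ∈ openSegment ℝ (AffineMap.lineMap a b s) b := by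
    rw [AffineMap.lineMap_apply_zero]
    exact subset_openSegment_of_isPreconnected
      (fun _ => he.openSegment_lineMap_mem_nhdsWithin ⟨hs.1, hst.trans ht⟩) hT hTF hsT hb htT
      (hsb ▸ mem_image_of_mem _ ⟨hst, ht⟩) ha
  rw [hsb, (AffineMap.lineMap_injective ℝ he.ne).mem_set_image] at hmem
  exact not_lt.2 hs.1 hmem.1

end IsEdge

namespace IsPolygonal

theorem exists_isEdge_of_isPreconnected (h : IsPolygonal F V) (hT : IsPreconnected T)
    (hTF : T ⊆ F \ V) (hne : T.Nonempty) :
    ∃ a b, IsEdge F V a b ∧ T ⊆ openSegment ℝ a b ∧ V ∩ closure T ⊆ {a, b} := by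
  obtain ⟨x, hx⟩ := hne
  obtain ⟨a, b, he, hxab⟩ := h.exists_isEdge (hTF hx)
  have hsub : T ⊆ openSegment ℝ a b := subset_openSegment_of_isPreconnected he.mem_nhdsWithin hT
    (hTF.trans sdiff_subset) (fun ha => (hTF ha).2 he.left_mem)
    (fun hb => (hTF hb).2 he.right_mem) hx hxab
  refine ⟨a, b, he, hsub, fun v hv => ?_⟩
  have hvab : v ∈ segment ℝ a b := closure_minimal
    (hsub.trans (openSegment_subset_segment ℝ a b)) (isClosed_segment a b) hv.2
  by_contra hvne
  rw [mem_insert_iff, mem_singleton_iff, not_or] at hvne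
  exact (he.subset (mem_openSegment_of_ne_left_right (Ne.symm hvne.1) (Ne.symm hvne.2) hvab)).2
    hv.1

theorem subset_openSegment (h : IsPolygonal F V) (hT : IsPreconnected T) (hTF : T ⊆ F \ V)
    (ha : a ∈ V ∩ closure T) (hb : b ∈ V ∩ closure T) (hab : a ≠ b) :
    T ⊆ openSegment ℝ a b := by
  obtain ⟨a', b', -, hsub, hends⟩ :=
    h.exists_isEdge_of_isPreconnected hT hTF (closure_nonempty_iff.1 ⟨a, ha.2⟩)
  rwa [openSegment_eq_of_mem_pair hab (hends ha) (hends hb)] at hsub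

theorem mapsTo_openSegment (h : IsPolygonal F V) {g : E → E} (hg : ContinuousOn g F)
    (hgi : InjOn g F) (hgm : MapsTo g F F) (hgV : ∀ v ∈ V, g v = v) (he : IsEdge F V a b) :
    MapsTo g (openSegment ℝ a b) (openSegment ℝ a b) := by
  have hsubF : openSegment ℝ a b ⊆ F := he.subset.trans sdiff_subset
  have hcl : ∀ v ∈ V, v ∈ segment ℝ a b → v ∈ V ∩ closure (g '' openSegment ℝ a b) := by
    intro v hv hvab
    refine ⟨hv, hgV v hv ▸ ContinuousWithinAt.mem_closure_image ?_ ?_⟩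
    · exact (hg v (h.corners_subset hv)).mono hsubF
    · rwa [closure_openSegment]
  refine mapsTo_iff_image_subset.2 (h.subset_openSegment
    ((convex_openSegment a b).isPreconnected.image g (hg.mono hsubF)) ?_
    (hcl a he.left_mem (left_mem_segment ℝ a b)) (hcl b he.right_mem (right_mem_segment ℝ a b))
    he.ne)
  rintro _ ⟨x, hx, rfl⟩
  refine ⟨hgm (hsubF hx), fun hgx => (he.subset hx).2 ?_⟩
  rwa [hgi (hsubF hx) (h.corners_subset hgx) (hgV _ hgx).symm]

end IsPolygonal

theorem IsEdge.mem_pair_of_isLink {v : E} (he : IsEdge F V a b) (hT : IsLink F V T x v)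
    (hx : x ∈ openSegment ℝ a b) (hv : v ∈ V) : v ∈ ({a, b} : Set E) := by
  rcases he.left_mem_or_right_mem hT.isPreconnected hT.subset hT.left_mem hx hT.right_mem
    (fun hvab => (he.subset hvab).2 hv) with ha | hb
  · exact Or.inl (hT.subsingleton ⟨hv, hT.right_mem⟩ ⟨he.left_mem, ha⟩)
  · exact Or.inr (hT.subsingleton ⟨hv, hT.right_mem⟩ ⟨he.right_mem, hb⟩)

namespace IsLinkedMap

variable {g : E → E}

theorem apply_lineMap_mem_pair (hg : IsLinkedMap F V g) (hV : V ⊆ F) (he : IsEdge F V a b)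
    {r : ℝ} (hr : r ∈ Ico 0 1) (hgr : g (AffineMap.lineMap a b r) ∈ V) :
    g (AffineMap.lineMap a b r) ∈ ({a, b} : Set E) := by
  rcases hr.1.eq_or_lt with rfl | hr0
  · rw [AffineMap.lineMap_apply_zero] at hgr ⊢
    exact Or.inl (hg.apply_eq_of_mem hV he.left_mem hgr)
  · have hmem : AffineMap.lineMap a b r ∈ openSegment ℝ a b :=
      openSegment_eq_image_lineMap ℝ a b ▸ mem_image_of_mem _ ⟨hr0, hr.2⟩
    obtain ⟨T, hT⟩ := hg.exists_isLink _ (he.subset hmem).1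
    exact he.mem_pair_of_isLink hT hmem hgr

theorem mapsTo_lineMap (hV : V ⊆ F) (he : IsEdge F V a b) :
    MapsTo (AffineMap.lineMap a b : ℝ → E) (Icc 0 1) F := fun _ hr =>
  he.segment_subset hV (segment_eq_image_lineMap ℝ a b ▸ mem_image_of_mem _ hr)

theorem continuousOn_comp_lineMap (hg : IsLinkedMap F V g) (hV : V ⊆ F) (he : IsEdge F V a b) :
    ContinuousOn (g ∘ (AffineMap.lineMap a b : ℝ → E)) (Icc 0 1) :=
  hg.continuousOn.comp AffineMap.lineMap_continuous.continuousOn (mapsTo_lineMap hV he)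

theorem injOn_comp_lineMap (hg : IsLinkedMap F V g) (hV : V ⊆ F) (he : IsEdge F V a b) :
    InjOn (g ∘ (AffineMap.lineMap a b : ℝ → E)) (Icc 0 1) :=
  hg.injOn.comp (AffineMap.lineMap_injective ℝ he.ne).injOn (mapsTo_lineMap hV he)

theorem apply_lineMap_mem_closure_image (hg : IsLinkedMap F V g) (hV : V ⊆ F)
    (he : IsEdge F V a b) {J : Set ℝ} (hJ : J ⊆ Icc 0 1) {r : ℝ} (hr : r ∈ closure J) :
    g (AffineMap.lineMap a b r) ∈ closure (g ∘ AffineMap.lineMap a b '' J) :=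
  ((hg.continuousOn_comp_lineMap hV he r (closure_minimal hJ isClosed_Icc hr)).mono
    hJ).mem_closure_image hr

theorem image_subset_sdiff_corners (hg : IsLinkedMap F V g) (hV : V ⊆ F) (he : IsEdge F V a b)
    {s t : ℝ} (hs : s ∈ Icc 0 1) (ht : t ∈ Icc 0 1) (hgs : g (AffineMap.lineMap a b s) = b)
    (hgt : g (AffineMap.lineMap a b t) = a) {J : Set ℝ} (hJ : J ⊆ Ico 0 1) (hsJ : s ∉ J)
    (htJ : t ∉ J) : g ∘ AffineMap.lineMap a b '' J ⊆ F \ V := by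
  rintro _ ⟨r, hr, rfl⟩
  have hrI : r ∈ Icc 0 1 := Ico_subset_Icc_self (hJ hr)
  refine ⟨hg.mapsTo (mapsTo_lineMap hV he hrI), fun hrV => ?_⟩
  rcases hg.apply_lineMap_mem_pair hV he (hJ hr) hrV with h | h
  · exact htJ (hg.injOn_comp_lineMap hV he hrI ht (h.trans hgt.symm) ▸ hr)
  · exact hsJ (hg.injOn_comp_lineMap hV he hrI hs (h.trans hgs.symm) ▸ hr)

theorem apply_left_mem_openSegment (hg : IsLinkedMap F V g) (h : IsPolygonal F V)
    (he : IsEdge F V a b) {s t : ℝ} (hs : 0 < s) (hst : s < t) (ht : t < 1)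
    (hgs : g (AffineMap.lineMap a b s) = b) (hgt : g (AffineMap.lineMap a b t) = a) :
    g a ∈ openSegment ℝ a b := by
  have hV := h.corners_subset
  have hc := hg.continuousOn_comp_lineMap hV he
  have hsI : s ∈ Icc 0 1 := ⟨hs.le, (hst.trans ht).le⟩
  have hsub : Ico 0 s ⊆ Icc 0 1 := fun r hr => ⟨hr.1, hr.2.le.trans hsI.2⟩
  obtain ⟨a', b', he', hab', hends⟩ := h.exists_isEdge_of_isPreconnected
    (isPreconnected_Ico.image _ (hc.mono hsub))
    (hg.image_subset_sdiff_corners hV he hsI ⟨(hs.trans hst).le, ht.le⟩ hgs hgt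
      (fun r hr => ⟨hr.1, hr.2.trans (hst.trans ht)⟩) (fun hc => lt_irrefl _ hc.2)
      (fun hc => lt_asymm hst hc.2)) ((nonempty_Ico.2 hs).image _)
  have hga : g a ∈ openSegment ℝ a' b' := hab' ⟨0, left_mem_Ico.2 hs, by simp⟩
  have hb : b ∈ ({a', b'} : Set E) := by
    have hs_cl : s ∈ closure (Ico 0 s) := closure_Ico hs.ne ▸ right_mem_Icc.2 hs.le
    refine hends ⟨he.right_mem, ?_⟩
    simpa only [hgs] using hg.apply_lineMap_mem_closure_image hV he hsub hs_cl
  have ha : a ∈ ({a', b'} : Set E) := by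
    obtain ⟨T, hT⟩ := hg.exists_isLink a (hV he.left_mem)
    exact he'.mem_pair_of_isLink hT.symm hga he.left_mem
  rwa [openSegment_eq_of_mem_pair he.ne ha hb] at hga

theorem image_Ioo_subset_openSegment (hg : IsLinkedMap F V g) (h : IsPolygonal F V)
    (he : IsEdge F V a b) {s t : ℝ} (hs : 0 < s) (hst : s < t) (ht : t < 1)
    (hgs : g (AffineMap.lineMap a b s) = b) (hgt : g (AffineMap.lineMap a b t) = a) :
    g ∘ AffineMap.lineMap a b '' Ioo s t ⊆ openSegment ℝ a b := by
  have hV := h.corners_subset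
  have hc := hg.continuousOn_comp_lineMap hV he
  have hsI : s ∈ Icc 0 1 := ⟨hs.le, (hst.trans ht).le⟩
  have htI : t ∈ Icc 0 1 := ⟨(hs.trans hst).le, ht.le⟩
  have hsub : Ioo s t ⊆ Icc 0 1 := fun r hr => ⟨hsI.1.trans hr.1.le, hr.2.le.trans htI.2⟩
  refine h.subset_openSegment (isPreconnected_Ioo.image _ (hc.mono hsub))
    (hg.image_subset_sdiff_corners hV he hsI htI hgs hgt
      (fun r hr => ⟨(hsub hr).1, hr.2.trans ht⟩) (fun hc => lt_irrefl _ hc.1)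
      (fun hc => lt_irrefl _ hc.2)) ⟨he.left_mem, ?_⟩ ⟨he.right_mem, ?_⟩ he.ne
  · have ht_cl : t ∈ closure (Ioo s t) := closure_Ioo hst.ne ▸ right_mem_Icc.2 hst.le
    simpa only [hgt] using hg.apply_lineMap_mem_closure_image hV he hsub ht_cl
  · have hs_cl : s ∈ closure (Ioo s t) := closure_Ioo hst.ne ▸ left_mem_Icc.2 hst.le
    simpa only [hgs] using hg.apply_lineMap_mem_closure_image hV he hsub hs_cl

/-- Otherwise the part of the edge between the two preimages would be mapped onto the whole edge,
which also contains the image of its end point `a`. -/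
theorem not_exchange (hg : IsLinkedMap F V g) (h : IsPolygonal F V) (he : IsEdge F V a b)
    {s t : ℝ} (hs : 0 < s) (hst : s < t) (ht : t < 1) (hgs : g (AffineMap.lineMap a b s) = b) :
    g (AffineMap.lineMap a b t) ≠ a := by
  intro hgt
  have hV := h.corners_subset
  have hsub : Icc s t ⊆ Icc 0 1 := Icc_subset_Icc hs.le ht.le
  have hseg : segment ℝ a b ⊆ g ∘ AffineMap.lineMap a b '' Icc s t := by
    refine segment_subset_of_isPreconnected (isPreconnected_Icc.image _
      ((hg.continuousOn_comp_lineMap hV he).mono hsub)) ?_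
      ⟨t, right_mem_Icc.2 hst.le, hgt⟩ ⟨s, left_mem_Icc.2 hst.le, hgs⟩
    rw [← Ioo_union_both hst.le, image_union, image_pair]
    refine union_subset ((hg.image_Ioo_subset_openSegment h he hs hst ht hgs hgt).trans
      (openSegment_subset_segment ℝ a b)) (pair_subset ?_ ?_)
    · exact (congrArg (· ∈ segment ℝ a b) hgs).mpr (right_mem_segment ℝ a b)
    · exact (congrArg (· ∈ segment ℝ a b) hgt).mpr (left_mem_segment ℝ a b)
  obtain ⟨r, hr, hgr⟩ := hseg (openSegment_subset_segment ℝ a b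
    (hg.apply_left_mem_openSegment h he hs hst ht hgs hgt))
  have hr0 : r = 0 := hg.injOn_comp_lineMap hV he (hsub hr) (by simp)
    (hgr.trans (by simp))
  exact not_lt.2 hr.1 (hr0 ▸ hs)

/-- Two corners whose preimages lie on the same edge cannot be exchanged, so that the part of the
edge between a corner and its preimage contains no other preimage. -/
theorem exists_isLink_subset (hg : IsLinkedMap F V g) (h : IsPolygonal F V) (hgx : g x ∈ V)
    (hT : IsLink F V T x (g x)) :
    ∃ K ⊆ T, IsLink F V K x (g x) ∧ ∀ y ∈ K, g y ∈ V → y = x := by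
  have hV := h.corners_subset
  have hxF := hT.subset hT.left_mem
  by_cases hxV : x ∈ V
  · have hfix : g x = x := hg.apply_eq_of_mem hV hxV hgx
    refine ⟨{x}, singleton_subset_iff.2 hT.left_mem, ?_, fun y hy _ => hy⟩
    exact ⟨isPreconnected_singleton, singleton_subset_iff.2 hxF, rfl, hfix,
      subsingleton_singleton.anti inter_subset_right⟩
  obtain ⟨b, he, hxb⟩ : ∃ b, IsEdge F V (g x) b ∧ x ∈ openSegment ℝ (g x) b := by
    obtain ⟨a, b, he, hxab⟩ := h.exists_isEdge ⟨hxF, hxV⟩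
    rcases he.mem_pair_of_isLink hT hxab hgx with h | h
    · exact ⟨b, h ▸ he, h ▸ hxab⟩
    · exact ⟨a, h ▸ he.symm, h ▸ openSegment_symm ℝ a b ▸ hxab⟩
  have hbT : b ∉ T := fun hb => he.ne (hT.subsingleton ⟨hgx, hT.right_mem⟩ ⟨he.right_mem, hb⟩)
  rw [openSegment_eq_image_lineMap] at hxb
  obtain ⟨t, ht, htx⟩ := hxb
  have hKT : AffineMap.lineMap (g x) b '' Icc (0 : ℝ) t ⊆ T := by
    rintro _ ⟨s, hs, rfl⟩
    exact he.lineMap_mem_of_isPreconnected hT.isPreconnected hT.subset hT.right_mem hbT hs ht.2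
      (by simpa only [htx] using hT.left_mem)
  refine ⟨_, hKT, ⟨isPreconnected_Icc.image _ AffineMap.lineMap_continuous.continuousOn,
    hKT.trans hT.subset, ⟨t, right_mem_Icc.2 ht.1.le, htx⟩, ⟨0, left_mem_Icc.2 ht.1.le, by simp⟩,
    hT.subsingleton.anti (inter_subset_inter_right V hKT)⟩, ?_⟩
  rintro y hyK hgy
  have hyF := hT.subset (hKT hyK)
  obtain ⟨s, hs, rfl⟩ := hyK
  have hpair := hg.apply_lineMap_mem_pair hV he ⟨hs.1, hs.2.trans_lt ht.2⟩ hgy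
  by_contra hne
  have hgyb := hpair.resolve_left fun hgyx => hne (hg.injOn hyF hxF hgyx)
  have hs0 : s ≠ 0 := by
    rintro rfl
    rw [AffineMap.lineMap_apply_zero] at hgy hgyb
    exact he.ne ((hg.apply_eq_of_mem hV hgx hgy).symm.trans hgyb)
  have hst : s ≠ t := fun hst => hne (hst ▸ htx)
  exact hg.not_exchange h he (hs.1.lt_of_ne' hs0) (hs.2.lt_of_ne hst) ht.2 hgyb
    (congrArg g htx)

end IsLinkedMap

end PolygonalCurve

section Polytope

theorem collinear_add_add_iff {E : Type*} [AddCommGroup E] [Module ℝ E] {x u v : E} :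
    Collinear ℝ {x, x + u, x + v} ↔ ¬LinearIndependent ℝ ![u, v] := by
  have hvsub : (fun i : {i : Fin 3 // i ≠ 0} => ![x, x + u, x + v] i -ᵥ ![x, x + u, x + v] 0) ∘
      finSuccAboveEquiv 0 = ![u, v] := by
    funext i
    fin_cases i <;> simp [finSuccAboveEquiv]
  rw [← hvsub, linearIndependent_equiv, ← affineIndependent_iff_linearIndependent_vsub,
    affineIndependent_iff_not_collinear_set, not_not]

theorem collinear_of_collinear_lineMap {E : Type*} [AddCommGroup E] [Module ℝ E] {x y z : E}
    {s t : ℝ} (hs : s ≠ 0) (ht : t ≠ 0)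
    (h : Collinear ℝ {x, AffineMap.lineMap x y s, AffineMap.lineMap x z t}) :
    Collinear ℝ {x, y, z} := by
  obtain ⟨v, hv⟩ := (collinear_iff_of_mem (p₀ := x) (by simp)).1 h
  refine (collinear_iff_of_mem (p₀ := x) (by simp)).2 ⟨v, ?_⟩
  simp only [mem_insert_iff, mem_singleton_iff, forall_eq_or_imp, forall_eq, vadd_eq_add,
    AffineMap.lineMap_apply, vsub_eq_sub, add_left_inj] at hv ⊢
  obtain ⟨-, ⟨a, ha⟩, b, hb⟩ := hv
  refine ⟨⟨0, by simp⟩, ⟨s⁻¹ * a, ?_⟩, t⁻¹ * b, ?_⟩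
  · rw [mul_smul, ← ha, inv_smul_smul₀ hs, sub_add_cancel]
  · rw [mul_smul, ← hb, inv_smul_smul₀ ht, sub_add_cancel]

theorem mem_polytopeVertices_iff {P : Set Plane} {x : Plane} :
    x ∈ polytopeVertices P ↔ ∃ y z, ¬Collinear ℝ {x, y, z} ∧ segment ℝ x y ⊆ frontier P ∧
      segment ℝ x z ⊆ frontier P := by
  constructor
  · rintro ⟨u, v, huv, hu, hv⟩
    exact ⟨x + u, x + v, fun h => collinear_add_add_iff.1 h huv, hu, hv⟩
  · rintro ⟨y, z, hyz, hy, hz⟩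
    obtain ⟨u, rfl⟩ : ∃ u, y = x + u := ⟨y - x, by simp⟩
    obtain ⟨v, rfl⟩ : ∃ v, z = x + v := ⟨z - x, by simp⟩
    exact ⟨u, v, not_not.1 fun h => hyz (collinear_add_add_iff.2 h), hy, hz⟩

theorem polytopeVertices_subset_frontier (P : Set Plane) : polytopeVertices P ⊆ frontier P := by
  rintro x ⟨u, v, -, hu, -⟩
  exact hu (left_mem_segment ℝ _ _)

theorem collinear_segment {E : Type*} [AddCommGroup E] [Module ℝ E] (a b : E) :
    Collinear ℝ (segment ℝ a b) :=
  ((collinear_iff_of_mem (left_mem_segment ℝ a b)).2 ⟨b - a, fun p hp => by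
    rw [segment_eq_image_lineMap] at hp
    obtain ⟨t, -, rfl⟩ := hp
    exact ⟨t, AffineMap.lineMap_apply a b t⟩⟩)

theorem eventually_forall_mem_imp_mem {ι X : Type*} [TopologicalSpace X] (S : Finset ι)
    {A : ι → Set X} (hA : ∀ i ∈ S, IsClosed (A i)) (x : X) :
    ∀ᶠ y in 𝓝 x, ∀ i ∈ S, y ∈ A i → x ∈ A i := by
  rw [Filter.eventually_all_finset]
  intro i hi
  by_cases hx : x ∈ A i
  · simp [hx]
  · filter_upwards [(hA i hi).isOpen_compl.mem_nhds hx] with y hy hy'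
    exact absurd hy' hy

theorem subsingleton_setOf_not_collinear {E : Type*} [AddCommGroup E] [Module ℝ E] {A B : Set E}
    (hA : Collinear ℝ A) (hB : Collinear ℝ B) :
    {x | x ∈ A ∩ B ∧ ∃ y ∈ A, ∃ z ∈ B, ¬Collinear ℝ {x, y, z}}.Subsingleton := by
  rintro x ⟨⟨hxA, hxB⟩, y, hy, z, hz, hxyz⟩ x' ⟨⟨hxA', hxB'⟩, -⟩
  by_contra hne
  refine hxyz ((collinear_insert_insert_of_mem_affineSpan_pair
    (hA.mem_affineSpan_of_mem_of_ne hxA hxA' hy hne)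
    (hB.mem_affineSpan_of_mem_of_ne hxB hxB' hz hne)).subset ?_)
  grind

section FiniteUnion

variable {E : Type*} [NormedAddCommGroup E] [NormedSpace ℝ E] {F : Set E} {S : Finset (E × E)}

theorem eventually_exists_segment (hF : F = ⋃ s ∈ S, segment ℝ s.1 s.2) (x : E) :
    ∀ᶠ y in 𝓝 x, y ∈ F → ∃ s ∈ S, x ∈ segment ℝ s.1 s.2 ∧ y ∈ segment ℝ s.1 s.2 := by
  filter_upwards [eventually_forall_mem_imp_mem S (fun s _ => isClosed_segment s.1 s.2) x]
    with y hy hyF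
  rw [hF, mem_iUnion₂] at hyF
  obtain ⟨s, hs, hys⟩ := hyF
  exact ⟨s, hs, hy s hs hys, hys⟩

theorem eventually_segment_subset (hF : F = ⋃ s ∈ S, segment ℝ s.1 s.2) (x : E) :
    ∀ᶠ y in 𝓝 x, y ∈ F → segment ℝ x y ⊆ F := by
  filter_upwards [eventually_exists_segment hF x] with y hy hyF
  obtain ⟨s, hs, hxs, hys⟩ := hy hyF
  rw [hF]
  exact ((convex_segment s.1 s.2).segment_subset hxs hys).trans
    (subset_biUnion_of_mem (u := fun s : E × E => segment ℝ s.1 s.2) hs)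

theorem exists_lineMap_mem_segment (hF : F = ⋃ s ∈ S, segment ℝ s.1 s.2) {x y : E}
    (hxy : segment ℝ x y ⊆ F) :
    ∃ s ∈ S, x ∈ segment ℝ s.1 s.2 ∧
      ∃ t : ℝ, t ≠ 0 ∧ AffineMap.lineMap x y t ∈ segment ℝ s.1 s.2 := by
  have htend : Tendsto (AffineMap.lineMap x y : ℝ → E) (𝓝[>] 0) (𝓝 x) :=
    (AffineMap.lineMap_continuous.tendsto' 0 x (AffineMap.lineMap_apply_zero x y)).mono_left
      nhdsWithin_le_nhds
  obtain ⟨t, hmem, ht₀, ht₁⟩ := ((htend.eventually (eventually_exists_segment hF x)).and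
    (Ioo_mem_nhdsGT one_pos)).exists
  obtain ⟨s, hs, hxs, hts⟩ := hmem (hxy (by
    rw [segment_eq_image_lineMap]
    exact mem_image_of_mem _ ⟨ht₀.le, ht₁.le⟩))
  exact ⟨s, hs, hxs, t, ht₀.ne', hts⟩

end FiniteUnion

namespace IsBoundedPolytope

variable {P : Set Plane} {x : Plane}

theorem finite_polytopeVertices (hP : IsBoundedPolytope P) : (polytopeVertices P).Finite := by
  obtain ⟨S, hS⟩ := hP.frontier_eq
  refine Set.Finite.subset ((S ×ˢ S).finite_toSet.biUnion fun p _ =>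
    (subsingleton_setOf_not_collinear (collinear_segment p.1.1 p.1.2)
      (collinear_segment p.2.1 p.2.2)).finite) fun x hx => ?_
  obtain ⟨y, z, hxyz, hy, hz⟩ := mem_polytopeVertices_iff.1 hx
  obtain ⟨s, hs, hxs, t, ht, hts⟩ := exists_lineMap_mem_segment hS hy
  obtain ⟨s', hs', hxs', t', ht', hts'⟩ := exists_lineMap_mem_segment hS hz
  refine mem_biUnion (x := (s, s')) (by simp [hs, hs'])
    ⟨⟨hxs, hxs'⟩, _, hts, _, hts', mt (collinear_of_collinear_lineMap ht ht') hxyz⟩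

theorem exists_eventually_mem_line (hP : IsBoundedPolytope P) (hx : x ∉ polytopeVertices P) :
    ∃ y ≠ x, ∀ᶠ z in 𝓝 x, z ∈ frontier P → z ∈ line[ℝ, x, y] := by
  obtain ⟨S, hS⟩ := hP.frontier_eq
  have hstar := eventually_segment_subset hS x
  by_cases! h : ∃ y ≠ x, segment ℝ x y ⊆ frontier P
  · obtain ⟨y, hyx, hy⟩ := h
    refine ⟨y, hyx, hstar.mono fun z hz hzP => ?_⟩
    have hcol : Collinear ℝ {x, y, z} := not_not.1 fun hcol =>
      hx (mem_polytopeVertices_iff.2 ⟨y, z, hcol, hy, hz hzP⟩)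
    exact hcol.mem_affineSpan_of_mem_of_ne (by simp) (by simp) (by simp) hyx.symm
  · obtain ⟨y, hyx⟩ := exists_ne x
    refine ⟨y, hyx, hstar.mono fun z hz hzP => ?_⟩
    obtain rfl : z = x := by_contra fun hzx => h z hzx (hz hzP)
    exact left_mem_affineSpan_pair ℝ _ _

end IsBoundedPolytope

theorem image_Icc_mem_nhds {f : ℝ → ℝ} {a b x : ℝ} (hf : ContinuousOn f (Icc a b))
    (hinj : InjOn f (Icc a b)) (hx : x ∈ Ioo a b) : f '' Icc a b ∈ 𝓝 (f x) := by
  have hab : a ≤ b := (hx.1.trans hx.2).le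
  have hmem := Ioo_subset_Icc_self hx
  rcases hf.strictMonoOn_of_injOn_Icc' hab hinj with hmono | hanti
  · exact mem_of_superset (Icc_mem_nhds (hmono (left_mem_Icc.2 hab) hmem hx.1)
      (hmono hmem (right_mem_Icc.2 hab) hx.2)) (intermediate_value_Icc hab hf)
  · exact mem_of_superset (Icc_mem_nhds (hanti hmem (right_mem_Icc.2 hab) hx.2)
      (hanti (left_mem_Icc.2 hab) hmem hx.1)) (intermediate_value_Icc' hab hf)

theorem eventually_mem_of_mem_line {E : Type*} [NormedAddCommGroup E] [NormedSpace ℝ E] {F : Set E}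
    {x y : E} (hyx : y ≠ x) (hline : ∀ᶠ z in 𝓝 x, z ∈ F → z ∈ line[ℝ, x, y]) {c : ℝ → E}
    {U : Set ℝ} (hU : U ∈ 𝓝 0) (hc : ContinuousOn c U) (hinj : InjOn c U) (hcF : MapsTo c U F)
    (hc₀ : c 0 = x) : ∀ᶠ z in 𝓝 x, z ∈ line[ℝ, x, y] → z ∈ F := by
  have hL := isInducing_lineMap hyx.symm
  have hnear : {t | t ∈ U ∧ c t ∈ line[ℝ, x, y]} ∈ 𝓝 0 := by
    have hct := (hc.continuousAt hU).tendsto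
    rw [hc₀] at hct
    filter_upwards [hU, hct.eventually hline] with t ht hline using ⟨ht, hline (hcF ht)⟩
  obtain ⟨δ, hδ, hI⟩ := Metric.nhds_basis_closedBall.mem_iff.1 hnear
  rw [Real.closedBall_eq_Icc, zero_sub, zero_add] at hI
  have hIU : Icc (-δ) δ ⊆ U := fun t ht => (hI ht).1
  choose! k hk using fun t (ht : t ∈ Icc (-δ) δ) =>
    mem_affineSpan_pair_iff_exists_lineMap_eq.1 (hI ht).2
  have hkc : ContinuousOn k (Icc (-δ) δ) :=
    hL.continuousOn_iff.2 ((hc.mono hIU).congr hk)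
  have hkinj : InjOn k (Icc (-δ) δ) := fun s hs t ht hst =>
    hinj (hIU hs) (hIU ht) (by rw [← hk s hs, ← hk t ht, hst])
  have h₀ : (0 : ℝ) ∈ Ioo (-δ) δ := by simpa
  obtain ⟨N, hN, hNk⟩ : k '' Icc (-δ) δ ∈ comap (AffineMap.lineMap x y) (𝓝 x) := by
    have h := image_Icc_mem_nhds hkc hkinj h₀
    rwa [hL.nhds_eq_comap, hk 0 (Ioo_subset_Icc_self h₀), hc₀] at h
  filter_upwards [hN] with z hz hzline
  obtain ⟨s, rfl⟩ := mem_affineSpan_pair_iff_exists_lineMap_eq.1 hzline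
  obtain ⟨t, ht, rfl⟩ := hNk hz
  exact hk t ht ▸ hcF (hIU ht)

theorem IsLipschitzDomain.exists_curve {Ω : Set Plane} (hΩ : IsLipschitzDomain Ω) {q : Plane}
    (hq : q ∈ frontier Ω) : ∃ γ : ℝ → Plane, Continuous γ ∧ γ.Injective ∧ γ 0 = q ∧
      γ ⁻¹' frontier Ω ∈ 𝓝 0 := by
  obtain ⟨r, S, e, κ, hS⟩ := hΩ.exists_isBoundaryChart hq
  have hSq : (S q).2 = 0 :=
    (hS.mem_frontier_iff hΩ.isOpen (Metric.mem_ball_self hS.radius_pos)).1 hq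
  let γ : ℝ → Plane := fun t => S.symm (t + (S q).1, 0)
  have hγ : Continuous γ := hS.isBilipschitz.toHomeomorph.symm.continuous.comp (by fun_prop)
  have hγ₀ : γ 0 = q := by simp [γ, S.symm_apply_eq, Prod.ext_iff, hSq]
  refine ⟨γ, hγ, fun s t hst => by simpa [γ] using hst, hγ₀, ?_⟩
  filter_upwards [hγ.tendsto' 0 q hγ₀ (Metric.ball_mem_nhds q hS.radius_pos)] with t ht
  exact (hS.mem_frontier_iff hΩ.isOpen ht).2 (by simp [γ])

theorem continuousOn_image_of_leftInvOn {X Y : Type*} [TopologicalSpace X] [TopologicalSpace Y]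
    [T2Space Y] {s : Set X} (hs : IsCompact s) {f : X → Y} (hf : ContinuousOn f s) {g : Y → X}
    (hg : LeftInvOn g f s) : ContinuousOn g (f '' s) := by
  refine continuousOn_iff_isClosed.2 fun t ht => ⟨f '' (s ∩ t),
    ((hs.inter_right ht).image_of_continuousOn (hf.mono inter_subset_left)).isClosed, ?_⟩
  rw [inter_comm s t, hg.image_inter', inter_assoc, inter_self]

namespace IsPolytopalModel

variable {Ω P : Set Plane} {Ψ : Plane → Plane}

theorem isCompact_closure (h : IsPolytopalModel Ω P Ψ) : IsCompact (closure P) :=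
  h.regular.1.isBounded.isCompact_closure

theorem continuousOn (h : IsPolytopalModel Ω P Ψ) : ContinuousOn Ψ (closure P) :=
  h.lipschitz.choose_spec.continuousOn

theorem isCompact_closure_domain (h : IsPolytopalModel Ω P Ψ) : IsCompact (closure Ω) :=
  h.bijOn_closure.image_eq ▸ h.isCompact_closure.image_of_continuousOn h.continuousOn

theorem invOn (h : IsPolytopalModel Ω P Ψ) :
    InvOn (modelInverse P Ψ) Ψ (closure P) (closure Ω) :=
  h.bijOn_closure.invOn_invFunOn

theorem bijOn_inverse_closure (h : IsPolytopalModel Ω P Ψ) :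
    BijOn (modelInverse P Ψ) (closure Ω) (closure P) :=
  h.bijOn_closure.symm h.invOn.symm

theorem bijOn_inverse (h : IsPolytopalModel Ω P Ψ) : BijOn (modelInverse P Ψ) Ω P :=
  h.bijOn.symm (h.invOn.symm.mono subset_closure subset_closure)

theorem bijOn_frontier (h : IsPolytopalModel Ω P Ψ) (hΩ : IsOpen Ω) :
    BijOn Ψ (frontier P) (frontier Ω) :=
  _root_.bijOn_frontier h.regular.1.isOpen hΩ h.bijOn h.bijOn_closure

theorem bijOn_inverse_frontier (h : IsPolytopalModel Ω P Ψ) (hΩ : IsOpen Ω) :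
    BijOn (modelInverse P Ψ) (frontier Ω) (frontier P) :=
  _root_.bijOn_frontier hΩ h.regular.1.isOpen h.bijOn_inverse h.bijOn_inverse_closure

theorem continuousOn_inverse (h : IsPolytopalModel Ω P Ψ) :
    ContinuousOn (modelInverse P Ψ) (closure Ω) :=
  h.bijOn_closure.image_eq ▸
    continuousOn_image_of_leftInvOn h.isCompact_closure h.continuousOn h.invOn.1

theorem isPolygonal_frontier (h : IsPolytopalModel Ω P Ψ) (hΩ : IsLipschitzDomain Ω) :
    IsPolygonal (frontier P) (polytopeVertices P) where
  isCompact := h.isCompact_closure.of_isClosed_subset isClosed_frontier frontier_subset_closure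
  isClosed_corners := h.regular.1.finite_polytopeVertices.isClosed
  corners_subset := polytopeVertices_subset_frontier P
  eventually_mem_iff x hx := by
    obtain ⟨y, hyx, hline⟩ := h.regular.1.exists_eventually_mem_line hx.2
    obtain ⟨γ, hγ, hγinj, hγ₀, hU⟩ := hΩ.exists_curve ((h.bijOn_frontier hΩ.isOpen).mapsTo hx.1)
    have hinv := h.bijOn_inverse_frontier hΩ.isOpen
    refine ⟨y, hyx, (hline.and (eventually_mem_of_mem_line hyx hline hU
      (c := modelInverse P Ψ ∘ γ) ?_ ?_ (fun t ht => hinv.mapsTo ht) ?_)).mono fun z hz =>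
        ⟨hz.1, hz.2⟩⟩
    · exact h.continuousOn_inverse.comp hγ.continuousOn fun t ht => frontier_subset_closure ht
    · exact hinv.injOn.comp hγinj.injOn fun t ht => ht
    · rw [Function.comp_apply, hγ₀, h.invOn.1 (frontier_subset_closure hx.1)]

end IsPolytopalModel

end Polytope

section BoundaryDistance

variable {Ω P₁ P₂ : Set Plane} {x y : Plane} {γ : ℝ → Plane} {s t c : ℝ}

theorem norm_derivWithin_comp_lineMap (hγ : DifferentiableOn ℝ γ (Icc 0 1)) (hs : s ∈ Icc (0 : ℝ) 1)
    (ht : t ∈ Icc (0 : ℝ) 1) {τ : ℝ} (hτ : τ ∈ Icc (0 : ℝ) 1) :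
    ‖derivWithin (γ ∘ AffineMap.lineMap s t) (Icc 0 1) τ‖ =
      |t - s| * ‖derivWithin γ (Icc 0 1) (AffineMap.lineMap s t τ)‖ := by
  have hmaps : MapsTo (AffineMap.lineMap s t) (Icc (0 : ℝ) 1) (Icc 0 1) := fun τ hτ =>
    (convex_Icc 0 1).lineMap_mem hs ht hτ
  rw [((hγ _ (hmaps hτ)).hasDerivWithinAt.scomp τ AffineMap.hasDerivWithinAt_lineMap
    hmaps).derivWithin (uniqueDiffOn_Icc zero_lt_one τ hτ), norm_smul, Real.norm_eq_abs]

theorem integral_norm_derivWithin_eq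
    (hc : ∀ t ∈ Icc (0 : ℝ) 1, ‖derivWithin γ (Icc 0 1) t‖ = c) :
    ∫ t in (0 : ℝ)..1, ‖derivWithin γ (Icc 0 1) t‖ = c := by
  rw [intervalIntegral.integral_congr (g := fun _ => c) (by rwa [uIcc_of_le zero_le_one])]
  simp

theorem boundaryDist_le_of_mem_boundaryCurves (hγ : γ ∈ boundaryCurves Ω x y)
    (hs : s ∈ Icc (0 : ℝ) 1) (ht : t ∈ Icc (0 : ℝ) 1) :
    boundaryDist Ω (γ s) (γ t) ≤
      ENNReal.ofReal (∫ τ in (0 : ℝ)..1, ‖derivWithin γ (Icc 0 1) τ‖) := by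
  obtain ⟨hdiff, hΩ, -, -, c, hc⟩ := hγ
  have hmaps : MapsTo (AffineMap.lineMap s t) (Icc (0 : ℝ) 1) (Icc 0 1) := fun τ hτ =>
    (convex_Icc 0 1).lineMap_mem hs ht hτ
  have hspeed : ∀ τ ∈ Icc (0 : ℝ) 1,
      ‖derivWithin (γ ∘ AffineMap.lineMap s t) (Icc 0 1) τ‖ = |t - s| * c := fun τ hτ => by
    rw [norm_derivWithin_comp_lineMap (hdiff.differentiableOn one_ne_zero) hs ht hτ,
      hc _ (hmaps hτ)]
  have hcurve : γ ∘ AffineMap.lineMap s t ∈ boundaryCurves Ω (γ s) (γ t) :=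
    ⟨hdiff.comp (AffineMap.contDiff_lineMap s t).contDiffOn hmaps,
      fun τ hτ => hΩ _ (hmaps hτ), by simp, by simp, _, hspeed⟩
  refine (iInf₂_le _ hcurve).trans (ENNReal.ofReal_le_ofReal ?_)
  rw [integral_norm_derivWithin_eq hspeed, integral_norm_derivWithin_eq hc]
  refine mul_le_of_le_one_left ?_ (abs_le.2 ⟨?_, ?_⟩)
  · exact hc 0 (by simp) ▸ norm_nonneg _
  · linarith [hs.2, ht.1]
  · linarith [hs.1, ht.2]

theorem exists_isPreconnected_of_boundaryDist_lt {C : ℝ≥0∞} (h : boundaryDist Ω x y < C) :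
    ∃ T ⊆ frontier Ω, IsPreconnected T ∧ x ∈ T ∧ y ∈ T ∧
      ∀ a ∈ T, ∀ b ∈ T, boundaryDist Ω a b < C := by
  simp only [boundaryDist, iInf_lt_iff] at h
  obtain ⟨γ, hγ, hlt⟩ := h
  refine ⟨γ '' Icc 0 1, image_subset_iff.2 hγ.2.1, isPreconnected_Icc.image _ hγ.1.continuousOn,
    ⟨0, by simp, hγ.2.2.1⟩, ⟨1, by simp, hγ.2.2.2.1⟩, ?_⟩
  rintro _ ⟨s, hs, rfl⟩ _ ⟨t, ht, rfl⟩
  exact (boundaryDist_le_of_mem_boundaryCurves hγ hs ht).trans_lt hlt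

theorem deformationBound_le_of_polytopeVertices (hx : x ∈ polytopeVertices P₁)
    (hy : y ∈ polytopeVertices P₁) (hxy : x ≠ y) : deformationBound Ω P₁ P₂ ≤ boundaryDist Ω x y :=
  (min_le_right _ _).trans ((min_le_left _ _).trans
    ((iInf₂_le x hx).trans ((iInf₂_le y hy).trans (iInf_le _ hxy))))

theorem deformationBound_le_of_fictitiousVertices (hx : x ∈ fictitiousVertices Ω P₁)
    (hy : y ∈ fictitiousVertices Ω P₂) : deformationBound Ω P₁ P₂ ≤ boundaryDist Ω x y :=
  (min_le_left _ _).trans ((iInf₂_le x hx).trans (iInf₂_le y hy))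

theorem exists_isLink_of_boundaryDist_lt
    (h : boundaryDist Ω x y < deformationBound Ω P₁ P₂) :
    ∃ T, IsLink (frontier Ω) (polytopeVertices P₁) T x y ∧
      ∀ v ∈ fictitiousVertices Ω P₁, v ∈ T → Disjoint T (fictitiousVertices Ω P₂) := by
  obtain ⟨T, hTΩ, hT, hx, hy, hdist⟩ := exists_isPreconnected_of_boundaryDist_lt h
  refine ⟨T, ⟨hT, hTΩ, hx, hy, fun v hv w hw => ?_⟩, fun v hv hvT => disjoint_left.2 fun w hwT hw =>
    (hdist v hvT w hwT).not_ge (deformationBound_le_of_fictitiousVertices hv hw)⟩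
  by_contra hvw
  exact (hdist v hv.2 w hw.2).not_ge (deformationBound_le_of_polytopeVertices hv.1 hw.1 hvw)

end BoundaryDistance

section VertexMotion

theorem IsLink.image {X Y : Type*} [TopologicalSpace X] [TopologicalSpace Y] {F V T : Set X}
    {x y : X} (hT : IsLink F V T x y) (hV : V ⊆ F) {f : X → Y} (hf : ContinuousOn f F)
    (hinj : InjOn f F) : IsLink (f '' F) (f '' V) (f '' T) (f x) (f y) where
  isPreconnected := hT.isPreconnected.image f (hf.mono hT.subset)
  subset := image_mono hT.subset
  left_mem := mem_image_of_mem f hT.left_mem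
  right_mem := mem_image_of_mem f hT.right_mem
  subsingleton := hinj.image_inter hV hT.subset ▸ hT.subsingleton.image f

theorem IsLinkedMap.conj {X Y : Type*} [TopologicalSpace X] [TopologicalSpace Y] {F : Set X}
    {F' V' : Set Y} {g : Y → Y} (hg : IsLinkedMap F' V' g) (hV' : V' ⊆ F') {ψ : X → Y} {φ : Y → X}
    (hψ : ContinuousOn ψ F) (hψF : BijOn ψ F F') (hφ : ContinuousOn φ F') (hφF : BijOn φ F' F)
    (hφψ : LeftInvOn φ ψ F) : IsLinkedMap F (φ '' V') (φ ∘ g ∘ ψ) where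
  continuousOn := hφ.comp (hg.continuousOn.comp hψ hψF.mapsTo) (hg.mapsTo.comp hψF.mapsTo)
  injOn := hφF.injOn.comp (hg.injOn.comp hψF.injOn hψF.mapsTo) (hg.mapsTo.comp hψF.mapsTo)
  mapsTo := hφF.mapsTo.comp (hg.mapsTo.comp hψF.mapsTo)
  exists_isLink x hx := by
    obtain ⟨T, hT⟩ := hg.exists_isLink (ψ x) (hψF.mapsTo hx)
    have himage := hT.image hV' hφ hφF.injOn
    rw [hφF.image_eq, hφψ hx] at himage
    exact ⟨_, himage⟩

variable {Ω P P₁ P₂ : Set Plane} {Φ Ψ Ψ₁ Ψ₂ : Plane → Plane} {x : Plane}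

theorem IsPolytopalModel.inverse_eq_on_vertices (h : IsPolytopalModel Ω P Ψ)
    (hx : x ∈ polytopeVertices P) : modelInverse P Ψ x = x := by
  have hinv := h.invOn.1 (frontier_subset_closure (polytopeVertices_subset_frontier P hx))
  rwa [h.eq_on_vertices x hx] at hinv

theorem IsPolytopalModel.exists_isLink_subset (h : IsPolytopalModel Ω P Ψ)
    (hΩ : IsLipschitzDomain Ω) (hΦ : IsLinkedMap (frontier Ω) (polytopeVertices P) Φ)
    (hΦx : Φ x ∈ polytopeVertices P) {T : Set Plane}
    (hT : IsLink (frontier Ω) (polytopeVertices P) T x (Φ x)) :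
    ∃ K ⊆ T, IsLink (frontier Ω) (polytopeVertices P) K x (Φ x) ∧
      ∀ y ∈ K, Φ y ∈ polytopeVertices P → y = x := by
  have hψ := h.bijOn_frontier hΩ.isOpen
  have hψc : ContinuousOn Ψ (frontier P) := h.continuousOn.mono frontier_subset_closure
  have hφ := h.bijOn_inverse_frontier hΩ.isOpen
  have hφc : ContinuousOn (modelInverse P Ψ) (frontier Ω) :=
    h.continuousOn_inverse.mono frontier_subset_closure
  have hinv : InvOn (modelInverse P Ψ) Ψ (frontier P) (frontier Ω) :=
    h.invOn.mono frontier_subset_closure frontier_subset_closure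
  have hψV : Ψ '' polytopeVertices P = polytopeVertices P :=
    (image_congr h.eq_on_vertices).trans (image_id' _)
  have hφV : modelInverse P Ψ '' polytopeVertices P = polytopeVertices P :=
    (image_congr fun v hv => h.inverse_eq_on_vertices hv).trans (image_id' _)
  have hg := hΦ.conj h.vertices_subset hψc hψ hφc hφ hinv.1
  have hT' := hT.image h.vertices_subset hφc hφ.injOn
  rw [hφV] at hg hT'
  have hx := hT.subset hT.left_mem
  set g := modelInverse P Ψ ∘ Φ ∘ Ψ
  have hgφ : ∀ y ∈ frontier Ω, g (modelInverse P Ψ y) = modelInverse P Ψ (Φ y) := fun y hy => by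
    simp only [g, Function.comp_apply, hinv.2 hy]
  rw [← hgφ x hx, hφ.image_eq] at hT'
  obtain ⟨K, hKT, hK, hKx⟩ := hg.exists_isLink_subset (h.isPolygonal_frontier hΩ)
    (by rwa [hgφ x hx, h.inverse_eq_on_vertices hΦx]) hT'
  have hK' := hK.image (polytopeVertices_subset_frontier P) hψc hψ.injOn
  rw [hψ.image_eq, hψV, hgφ x hx, hinv.2 hx, hinv.2 (hΦ.mapsTo hx)] at hK'
  refine ⟨Ψ '' K, ?_, hK', ?_⟩
  · rw [image_subset_iff]
    intro z hz
    obtain ⟨y, hy, rfl⟩ := hKT hz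
    simpa only [mem_preimage, hinv.2 (hT.subset hy)]
  · rintro _ ⟨y, hy, rfl⟩ hΦy
    rw [hKx y hy, hinv.2 hx]
    simpa only [g, Function.comp_apply, h.inverse_eq_on_vertices hΦy]

theorem IsLipschitzDomain.exists_mem_fixingGroup_eqOn (hΩ : IsLipschitzDomain Ω) {F X : Set Plane}
    (hF : IsClosed F) (hX : X.Finite)
    (hK : ∀ x ∈ X, Φ x ≠ x → ∃ K ⊆ frontier Ω, IsPreconnected K ∧ x ∈ K ∧ Φ x ∈ K ∧
      Disjoint K (F ∪ (X \ {x} ∪ Φ '' (X \ {x})))) :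
    ∃ B ∈ fixingGroup Ω F, EqOn B Φ X := by
  suffices h : ∃ B ∈ fixingGroup Ω F, EqOn B Φ X ∧ ∀ x ∈ X \ X, B x = x by
    obtain ⟨B, hB, hBX, -⟩ := h
    exact ⟨B, hB, hBX⟩
  refine hX.induction_on_subset (motive := fun s _ => ∃ B ∈ fixingGroup Ω F, EqOn B Φ s ∧
    ∀ x ∈ X \ s, B x = x) X ⟨1, one_mem _, eqOn_empty _ _, fun x _ => rfl⟩ ?_
  rintro x s hx hs hxs ⟨B, hB, hBs, hBX⟩
  obtain ⟨B', hB', hB'x⟩ : ∃ B' ∈ fixingGroup Ω (F ∪ (X \ {x} ∪ Φ '' (X \ {x}))), B' x = Φ x := by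
    by_cases hΦx : Φ x = x
    · exact ⟨1, one_mem _, hΦx.symm⟩
    obtain ⟨K, hKΩ, hKc, hxK, hΦxK, hKF⟩ := hK x hx hΦx
    have hXx : (X \ {x}).Finite := hX.subset sdiff_subset
    exact hΩ.exists_mem_fixingGroup (hF.union (hXx.union (hXx.image Φ)).isClosed) hKc hKΩ hKF
      hxK hΦxK
  have hB'fix := hB'.2.2
  refine ⟨B' * B, mul_mem (fixingGroup_antitone subset_union_left hB') hB, ?_, ?_⟩
  · rintro y (rfl | hy)
    · rw [Equiv.Perm.mul_apply, hBX y ⟨hx, hxs⟩, hB'x]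
    · rw [Equiv.Perm.mul_apply, hBs hy]
      exact hB'fix _ (.inr (.inr ⟨y, ⟨hs hy, ne_of_mem_of_not_mem hy hxs⟩, rfl⟩))
  · rintro y ⟨hyX, hy⟩
    rw [mem_insert_iff, not_or] at hy
    rw [Equiv.Perm.mul_apply, hBX y ⟨hyX, hy.2⟩]
    exact hB'fix y (.inr (.inl ⟨hyX, hy.1⟩))

theorem isLinkedMap_frontier (hΦ : ContinuousOn Φ (frontier Ω))
    (hΦΩ : BijOn Φ (frontier Ω) (frontier Ω))
    (hC : ∀ x ∈ frontier Ω, boundaryDist Ω x (Φ x) < deformationBound Ω P₁ P₂) :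
    IsLinkedMap (frontier Ω) (polytopeVertices P₁) Φ where
  continuousOn := hΦ
  injOn := hΦΩ.injOn
  mapsTo := hΦΩ.mapsTo
  exists_isLink x hx :=
    let ⟨T, hT, _⟩ := exists_isLink_of_boundaryDist_lt (hC x hx)
    ⟨T, hT⟩

theorem mem_fictitiousVertices_of_apply_ne (h₁ : IsPolytopalModel Ω P₁ Ψ₁)
    (hΦ : IsLinkedMap (frontier Ω) (polytopeVertices P₁) Φ)
    (hang : SurjOn Φ (angularPoints Ω) (angularPoints Ω)) (hx : x ∈ frontier Ω)
    (hΦx : Φ x ∈ polytopeVertices P₁) (hne : Φ x ≠ x) : Φ x ∈ fictitiousVertices Ω P₁ := by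
  refine ⟨hΦx, fun hΦang => hne ?_⟩
  obtain ⟨z, hz, hzx⟩ := hang hΦang
  obtain rfl : z = x := hΦ.injOn hz.1 hx hzx
  exact hΦ.apply_eq_of_mem h₁.vertices_subset (h₁.angular_subset hz) hΦx

theorem disjoint_polytopeVertices (h₁ : IsPolytopalModel Ω P₁ Ψ₁) {T : Set Plane} {v : Plane}
    (hv : v ∈ fictitiousVertices Ω P₁) (hvT : v ∈ T) (hT : (polytopeVertices P₁ ∩ T).Subsingleton)
    (hT₂ : Disjoint T (fictitiousVertices Ω P₂)) : Disjoint T (polytopeVertices P₂) := by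
  refine disjoint_left.2 fun w hwT hw => disjoint_left.1 hT₂ hwT ⟨hw, fun hwang => hv.2 ?_⟩
  rwa [hT ⟨hv.1, hvT⟩ ⟨h₁.angular_subset hwang, hwT⟩]

theorem exists_mem_fixingGroup_vertices (hΩ : IsLipschitzDomain Ω)
    (h₁ : IsPolytopalModel Ω P₁ Ψ₁) (h₂ : IsPolytopalModel Ω P₂ Ψ₂)
    (hΦ : ContinuousOn Φ (frontier Ω)) (hΦΩ : BijOn Φ (frontier Ω) (frontier Ω))
    (hang : SurjOn Φ (angularPoints Ω) (angularPoints Ω))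
    (hC : ∀ x ∈ frontier Ω, boundaryDist Ω x (Φ x) < deformationBound Ω P₁ P₂) :
    ∃ B ∈ fixingGroup Ω (polytopeVertices P₂),
      EqOn B Φ (frontier Ω ∩ Φ ⁻¹' polytopeVertices P₁) := by
  have hlinked := isLinkedMap_frontier hΦ hΦΩ hC
  refine hΩ.exists_mem_fixingGroup_eqOn h₂.regular.1.finite_polytopeVertices.isClosed
    (.of_finite_image (h₁.regular.1.finite_polytopeVertices.subset
      (image_subset_iff.2 inter_subset_right)) (hΦΩ.injOn.mono inter_subset_left)) ?_
  rintro x ⟨hx, hΦx⟩ hne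
  have hfict := mem_fictitiousVertices_of_apply_ne h₁ hlinked hang hx hΦx hne
  obtain ⟨T, hT, hT₂⟩ := exists_isLink_of_boundaryDist_lt (hC x hx)
  obtain ⟨K, hKT, hK, hKx⟩ := h₁.exists_isLink_subset hΩ hlinked hΦx hT
  refine ⟨K, hK.subset, hK.isPreconnected, hK.left_mem, hK.right_mem, disjoint_union_right.2
    ⟨(disjoint_polytopeVertices h₁ hfict hT.right_mem hT.subsingleton
      (hT₂ _ hfict hT.right_mem)).mono_left hKT, disjoint_union_right.2 ⟨?_, ?_⟩⟩⟩
  · exact disjoint_left.2 fun y hyK hy => hy.2 (hKx y hyK hy.1.2)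
  · refine disjoint_right.2 (forall_mem_image.2 fun y hy hΦyK => hy.2 ?_)
    exact hΦΩ.injOn hy.1.1 hx (hK.subsingleton ⟨hy.1.2, hΦyK⟩ ⟨hΦx, hK.right_mem⟩)

end VertexMotion

section TangentialDisplacement

theorem IsOutwardNormal.innerSL_mem_frechetNormalCone {P : Set Plane} {x ν : Plane}
    (hν : IsOutwardNormal P x ν) : innerSL ℝ ν ∈ frechetNormalCone (closure P) x := by
  rw [frechetNormalCone_closure]
  intro ε hε
  rw [eventually_nhdsWithin_iff]
  filter_upwards [hν.2 ε hε] with y hy hyP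
  rw [innerSL_apply_apply, real_inner_comm]
  exact hy.1 hyP

theorem eventually_lineMap_add_smul_mem_openSegment {E : Type*} [AddCommGroup E] [Module ℝ E]
    {a b : E} {s : ℝ} (hs : s ∈ Ioo (0 : ℝ) 1) (c : ℝ) :
    ∀ᶠ t in 𝓝[>] (0 : ℝ), AffineMap.lineMap a b s + t • c • (b - a) ∈ openSegment ℝ a b := by
  have hlim := tendsto_add_smul_nhdsGT_zero s c
  filter_upwards [hlim.eventually_mem (Ioo_mem_nhds hs.1 hs.2)] with t ht
  rw [openSegment_eq_image_lineMap]
  refine ⟨_, ht, ?_⟩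
  simp only [AffineMap.lineMap_apply_module', smul_eq_mul]
  module

theorem apply_sub_eq_zero_of_mem_frechetNormalCone {E : Type*} [NormedAddCommGroup E]
    [NormedSpace ℝ E] {A : Set E} {ℓ : E →L[ℝ] ℝ} {a b x y : E} (hA : openSegment ℝ a b ⊆ A)
    (hx : x ∈ openSegment ℝ a b) (hy : y ∈ openSegment ℝ a b) (hℓ : ℓ ∈ frechetNormalCone A x) :
    ℓ (y - x) = 0 := by
  rw [openSegment_eq_image_lineMap] at hx hy
  obtain ⟨s, hs, rfl⟩ := hx
  obtain ⟨t, -, rfl⟩ := hy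
  have hdir (c : ℝ) : ℓ (c • (b - a)) ≤ 0 := nonpos_of_mem_frechetNormalCone hℓ <|
    (eventually_lineMap_add_smul_mem_openSegment hs c).mono fun _ h => hA h
  have hsub : AffineMap.lineMap a b t - AffineMap.lineMap a b s = (t - s) • (b - a) := by
    simp only [AffineMap.lineMap_apply_module']
    module
  rw [hsub]
  refine (hdir _).antisymm ?_
  simpa only [neg_smul, map_neg, Left.neg_nonpos_iff] using hdir (-(t - s))

theorem isTangentialDisplacement_of_isPolygonal {P V : Set Plane} {g : Plane → Plane}
    (hPV : IsPolygonal (frontier P) V) (hP : IsOpen P) (hgc : ContinuousOn g (closure P))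
    (hg : BijOn g P P) (hg' : BijOn g (closure P) (closure P)) (hgV : ∀ v ∈ V, g v = v) :
    IsTangentialDisplacement P fun x => g x - x where
  continuousOn := hgc.sub continuousOn_id
  bijOn := by simpa only [add_sub_cancel] using hg
  bijOn_closure := by simpa only [add_sub_cancel] using hg'
  normal_eq_zero x hx ν hν := by
    by_cases hxV : x ∈ V
    · rw [hgV x hxV, sub_self, inner_zero_left]
    obtain ⟨a, b, he, hxab⟩ := hPV.exists_isEdge ⟨hx, hxV⟩
    have hgF : BijOn g (frontier P) (frontier P) := bijOn_frontier hP hP hg hg'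
    have hgx : g x ∈ openSegment ℝ a b := hPV.mapsTo_openSegment
      (hgc.mono frontier_subset_closure) hgF.injOn hgF.mapsTo hgV he hxab
    rw [real_inner_comm, ← innerSL_apply_apply ℝ]
    exact apply_sub_eq_zero_of_mem_frechetNormalCone
      (fun y hy => frontier_subset_closure (he.subset hy).1) hxab hgx
      hν.innerSL_mem_frechetNormalCone

variable {Ω P : Set Plane} {Ψ A : Plane → Plane}

/-- The displacement of the conjugate `Ψ⁻¹ ∘ A ∘ Ψ`, where `Ψ⁻¹` is `modelInverse P Ψ`: it reads a
self-map `A` of `Ω` in the polytope `P`. -/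
noncomputable def conjDisplacement (P : Set Plane) (Ψ A : Plane → Plane) (x : Plane) : Plane :=
  modelInverse P Ψ (A (Ψ x)) - x

namespace IsPolytopalModel

theorem isTangentialDisplacement (h : IsPolytopalModel Ω P Ψ) (hΩ : IsLipschitzDomain Ω)
    (hAc : ContinuousOn A (closure Ω)) (hA : BijOn A Ω Ω) (hA' : BijOn A (closure Ω) (closure Ω))
    (hV : ∀ v ∈ polytopeVertices P, A v = v) :
    IsTangentialDisplacement P (conjDisplacement P Ψ A) := by
  have hc : ContinuousOn (modelInverse P Ψ ∘ A ∘ Ψ) (closure P) :=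
    h.continuousOn_inverse.comp (hAc.comp h.continuousOn h.bijOn_closure.mapsTo)
      (hA'.mapsTo.comp h.bijOn_closure.mapsTo)
  refine isTangentialDisplacement_of_isPolygonal (h.isPolygonal_frontier hΩ) h.regular.1.isOpen hc
    (h.bijOn_inverse.comp (hA.comp h.bijOn))
    (h.bijOn_inverse_closure.comp (hA'.comp h.bijOn_closure)) fun v hv => ?_
  simp only [h.eq_on_vertices v hv, hV v hv, h.inverse_eq_on_vertices hv]

theorem exists_lipschitzOnWith_conjDisplacement (h : IsPolytopalModel Ω P Ψ)
    (hA : ∃ K, LipschitzOnWith K A (closure Ω)) (hA' : MapsTo A (closure Ω) (closure Ω))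
    (hinv : ∃ K, LipschitzOnWith K (modelInverse P Ψ) (closure Ω)) :
    ∃ K, LipschitzOnWith K (conjDisplacement P Ψ A) (closure P) := by
  obtain ⟨K, hK⟩ := hA
  obtain ⟨L, hL⟩ := hinv
  obtain ⟨M, hM⟩ := h.lipschitz
  exact ⟨_, (hL.comp (hK.comp hM h.bijOn_closure.mapsTo)
    (hA'.comp h.bijOn_closure.mapsTo)).sub LipschitzWith.id.lipschitzOnWith⟩

theorem apply_add_conjDisplacement_inverse (h : IsPolytopalModel Ω P Ψ)
    (hA : MapsTo A (closure Ω) (closure Ω)) {y : Plane} (hy : y ∈ closure Ω) :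
    Ψ (modelInverse P Ψ y + conjDisplacement P Ψ A (modelInverse P Ψ y)) = A y := by
  rw [conjDisplacement, add_sub_cancel, h.invOn.2 hy, h.invOn.2 (hA hy)]

end IsPolytopalModel

end TangentialDisplacement

theorem mainTheorem2_general {Ω P₁ P₂ : Set Plane} {Ψ₁ Ψ₂ Φ : Plane → Plane}
    (hΩ : IsLipschitzDomain Ω) (h₁ : IsPolytopalModel Ω P₁ Ψ₁) (h₂ : IsPolytopalModel Ω P₂ Ψ₂)
    (hΦ : BijOn Φ Ω Ω) (hΦ' : BijOn Φ (closure Ω) (closure Ω))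
    (hlip : ∃ K, LipschitzOnWith K Φ (closure Ω))
    (hang : SurjOn Φ (angularPoints Ω) (angularPoints Ω))
    (hC : ∀ x ∈ frontier Ω, boundaryDist Ω x (Φ x) < deformationBound Ω P₁ P₂) :
    ∃ Φ₁ Φ₂ φ₁ φ₂ : Plane → Plane,
      (∀ x, Φ₁ x = x + φ₁ x) ∧ (∀ x, Φ₂ x = x + φ₂ x) ∧
      IsTangentialDisplacement P₁ φ₁ ∧ IsTangentialDisplacement P₂ φ₂ ∧
      (∀ x ∈ closure Ω,
        Φ x = (Ψ₁ ∘ Φ₁ ∘ modelInverse P₁ Ψ₁ ∘ Ψ₂ ∘ Φ₂ ∘ modelInverse P₂ Ψ₂) x) ∧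
      ((∃ K : ℝ≥0, LipschitzOnWith K (modelInverse P₁ Ψ₁) (closure Ω)) →
        ∃ K : ℝ≥0, LipschitzOnWith K φ₁ (closure P₁)) ∧
      ((∃ K : ℝ≥0, LipschitzOnWith K (modelInverse P₂ Ψ₂) (closure Ω)) →
        ∃ K : ℝ≥0, LipschitzOnWith K φ₂ (closure P₂)) := by
  obtain ⟨L, hL⟩ := hlip
  have hΦF := bijOn_frontier hΩ.isOpen hΩ.isOpen hΦ hΦ'
  obtain ⟨B, hB, hBΦ⟩ := exists_mem_fixingGroup_vertices hΩ h₁ h₂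
    (hL.continuousOn.mono frontier_subset_closure) hΦF hang hC
  have ⟨⟨⟨K, hK⟩, ⟨K', hK'⟩⟩, _, hBfix⟩ := hB
  have hBcl := bijOn_closure_of_mem_fixingGroup hB
  have hBcl' := bijOn_closure_of_mem_fixingGroup (inv_mem hB)
  have hA : BijOn (Φ ∘ B.symm) (closure Ω) (closure Ω) := hΦ'.comp hBcl'
  have hAlip := hL.comp hK'.lipschitzOnWith hBcl'.mapsTo
  have hAV : ∀ v ∈ polytopeVertices P₁, (Φ ∘ B.symm) v = v := fun v hv => by
    obtain ⟨x, hx, rfl⟩ := hΦF.surjOn (h₁.vertices_subset hv)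
    rw [Function.comp_apply, B.symm_apply_eq.2 (hBΦ ⟨hx, hv⟩).symm]
  refine ⟨_, _, conjDisplacement P₁ Ψ₁ (Φ ∘ B.symm), conjDisplacement P₂ Ψ₂ B, fun _ => rfl,
    fun _ => rfl, h₁.isTangentialDisplacement hΩ hAlip.continuousOn
      (hΦ.comp (bijOn_of_mem_fixingGroup (inv_mem hB))) hA hAV,
    h₂.isTangentialDisplacement hΩ hK.continuous.continuousOn (bijOn_of_mem_fixingGroup hB) hBcl
      hBfix, fun x hx => ?_,
    h₁.exists_lipschitzOnWith_conjDisplacement ⟨_, hAlip⟩ hA.mapsTo,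
    h₂.exists_lipschitzOnWith_conjDisplacement ⟨_, hK.lipschitzOnWith⟩ hBcl.mapsTo⟩
  simp only [Function.comp_apply, h₂.apply_add_conjDisplacement_inverse hBcl.mapsTo hx,
    h₁.apply_add_conjDisplacement_inverse hA.mapsTo (hBcl.mapsTo hx), B.symm_apply_apply]

theorem mainTheorem2 (Ω : Set Plane) (hΩ : IsLipschitzDomain Ω)
    (P₁ P₂ : Set Plane) (Ψ₁ Ψ₂ : Plane → Plane)
    (h₁ : IsPolytopalModel Ω P₁ Ψ₁) (h₂ : IsPolytopalModel Ω P₂ Ψ₂)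
    (Φ : Plane → Plane) (hΦ : IsDomainDiffeo Ω Φ)
    (hJ : ∀ x ∈ Ω, 0 < (fderiv ℝ Φ x).det)
    (hC : ∀ x ∈ frontier Ω, boundaryDist Ω x (Φ x) < deformationBound Ω P₁ P₂) :
    ∃ Φ₁ Φ₂ φ₁ φ₂ : Plane → Plane,
      (∀ x, Φ₁ x = x + φ₁ x) ∧ (∀ x, Φ₂ x = x + φ₂ x) ∧
      IsTangentialDisplacement P₁ φ₁ ∧ IsTangentialDisplacement P₂ φ₂ ∧
      (∀ x ∈ closure Ω,
        Φ x = (Ψ₁ ∘ Φ₁ ∘ modelInverse P₁ Ψ₁ ∘ Ψ₂ ∘ Φ₂ ∘ modelInverse P₂ Ψ₂) x) ∧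
      ((∃ K : ℝ≥0, LipschitzOnWith K (modelInverse P₁ Ψ₁) (closure Ω)) →
        ∃ K : ℝ≥0, LipschitzOnWith K φ₁ (closure P₁)) ∧
      ((∃ K : ℝ≥0, LipschitzOnWith K (modelInverse P₂ Ψ₂) (closure Ω)) →
        ∃ K : ℝ≥0, LipschitzOnWith K φ₂ (closure P₂)) :=
  mainTheorem2_general hΩ h₁ h₂ hΦ.bijOn hΦ.bijOn_closure
    (hΩ.exists_lipschitzOnWith_of_contDiffOn h₁.isCompact_closure_domain hΦ.contDiffOn)
    (hΦ.surjOn_angularPoints hΩ) hC
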